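/- **Setting.** A *general Markov decision process* (gMDP) $\mathbf M=(\mathbb X,\mathbb U,\mathbb Y,x_0,\mathbf t,h)$ consists of Polish spaces $\mathbb X,\mathbb U$ of states and inputs, a metric output space $\mathbb Y$, an initial state $x_0$, a Borel stochastic kernel $\mathbf t(\cdot\mid x,u)$ on $\mathbb X$ and a measurable output map $h:\mathbb X\to\mathbb Y$. For a probability measure $\nu$ on $\mathbb U$ write $\mathbf t(\cdot\mid x,\nu)=\int \mathbf t(\cdot\mid x,u)\,\nu(du)$. A *control strategy* $\mathbf C$ for $\mathbf M$ has a Polish memory space $\mathbb X_{\mathbf C}$ with an initial state, a universally measurable kernel $\mathbf t_{\mathbf C}(\cdot\mid c,x)$ and a universally measurable output map $h_{\mathbf C}:\mathbb X_{\mathbf C}\to\mathcal P(\mathbb U)$. In the controlled model $\mathbf C\times\mathbf M$ a step from $(x,c)$ draws $c'\sim\mathbf t_{\mathbf C}(\cdot\mid c,x)$, then $u\sim h_{\mathbf C}(c')$, then $x'\sim\mathbf t(\cdot\mid x,u)$; $\mathbb P_{\mathbf C\times\mathbf M}$ is the resulting law of the executions. Let $AP$ be a finite set of atomic propositions, $\mathsf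 L:\mathbb Y\to 2^{AP}$ a measurable labelling function, and $\boldsymbol\omega=(\mathsf L(h(x_t)))_{t\ge0}$ the word of an execution. An scLTL formula is built from $p,\neg p$ ($p\in AP$), $\wedge,\vee$, next and until, with the usual semantics. For $\epsilon,\delta\ge 0$, write $\widehat{\mathbf M}\preceq^\delta_\epsilon\mathbf M$ if there are a measurable relation $\mathcal R\subseteq\hat{\mathbb X}\times\mathbb X$, a (universally measurable) interface $\mathcal U_v:\hat{\mathbb U}\times\hat{\mathbb X}\times\mathbb X\to\mathcal P(\mathbb U)$ and a Borel stochastic kernel $\mathbb W_{\mathbf t}(\cdot\mid\hat u,\hat x,x)$ on $\hat{\mathbb X}\times\mathbb X$ such that $(\hat x_0,x_0)\in\mathcal R$ and, for all $(\hat x,x)\in\mathcal R$: $\mathbf d_{\mathbb Y}(\hat h(\hat x),h(x))\le\epsilon$, and for all $\hat u$ the measure $\mathbb W_{\mathbf t}(\cdot\mid\hat u,\hat x,x)$ has marginals $\hat{\mathbf t}(\cdot\mid\hat x,\hat u)$ and $\mathbf t(\cdot\mid x,\mathcal U_v(\hat u,\hat x,x))$ and gives $\mathcal R$ mass at least $1-\delta$.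 A control strategy $\hat{\mathbf C}$ for $\widehat{\mathbf M}$ *$(\epsilon,\delta)$-robustly satisfies $\psi$ with probability $p$* if for every gMDP $\mathbf M$ with the same output space and $\widehat{\mathbf M}\preceq^\delta_\epsilon\mathbf M$ there is a control strategy $\mathbf C$ for $\mathbf M$ with $\mathbb P_{\mathbf C\times\mathbf M}(\boldsymbol\omega\models\psi)\ge p$. **Data.** Let $\widehat{\mathbf M}$ be a gMDP, $\psi$ an scLTL formula, $\mathcal A_\psi=(Q,q_0,2^{AP},F,\tau)$ a deterministic finite automaton such that $\boldsymbol\omega\models\psi$ if and only if the run of $\mathcal A_\psi$ on $\boldsymbol\omega$ visits $F$, and $\delta\ge0$. The product $\widehat{\mathbf M}\otimes\mathcal A_\psi$ has state space $\hat{\mathbb X}\times Q$, initial state $(\hat x_0,\bar q_0)$ with $\bar q_0=\tau(q_0,\mathsf L(\hat h(\hat x_0)))$, and moves from $(\hat x,q)$ to $(\hat x',\tau(q,\mathsf L(\hat h(\hat x'))))$ with $\hat x'\sim\hat{\mathbf t}(\cdot\mid\hat x,\hat u)$; let $\bar{\mathbf t}$ be its kernel. A stationary Markov policy $\boldsymbol\mu$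 on it is given by a universally measurable map $\mu:\hat{\mathbb X}\times Q\to\mathcal P(\hat{\mathbb U})$. Put $$\mathbf T^\mu(V)(\hat x,q)=\int\max\{\mathbf 1_F(q'),V(\hat x',q')\}\,\bar{\mathbf t}(d\hat x'\times dq'\mid\hat x,q,\mu(\hat x,q)),\qquad \mathbf T^\mu_\delta(V)=\mathbf L(\mathbf T^\mu(V)-\delta),$$ with $\mathbf L(a)=\min(1,\max(0,a))$, and $$V^\mu_\infty=\lim_{l\to\infty}(\mathbf T^\mu_\delta)^l(0),\qquad \mathcal S^{\boldsymbol\mu}_\delta=\max\{\mathbf 1_F(\bar q_0),V^\mu_\infty(\hat x_0,\bar q_0)\}.$$ **Theorem.** The function $V^\mu_\infty$ satisfies $\mathbf T^\mu_\delta(V^\mu_\infty)=V^\mu_\infty$, and for $\delta>0$ it is the only universally measurable solution $V:\hat{\mathbb X}\times Q\to[0,1]$ of $\mathbf T^\mu_\delta(V)=V$. The number $\mathcal S^{\boldsymbol\mu}_\delta$ is a $(0,\delta)$-robust satisfaction probability: the control strategy for $\widehat{\mathbf M}$ induced by $\boldsymbol\mu$ (its memory tracks the current state of $\widehat{\mathbf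 M}\otimes\mathcal A_\psi$, and it outputs the value of $\mu$ there) $(0,\delta)$-robustly satisfies $\psi$ with probability $\mathcal S^{\boldsymbol\mu}_\delta$. In particular, for every gMDP $\mathbf M$ with $\widehat{\mathbf M}\preceq^\delta_0\mathbf M$ there is a control strategy $\mathbf C$ such that $$\mathbb P_{\mathbf C\times\mathbf M}(\boldsymbol\omega\models\psi)\ge\mathcal S^{\boldsymbol\mu}_\delta .$$ -/

import Mathlib

open MeasureTheory ProbabilityTheory Filter Topology
open scoped ENNReal NNReal

universe u

noncomputable section

/-! ### Universally measurable maps -/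

/-- A map is universally measurable if preimages of measurable sets belong to the completion of
the domain's sigma-algebra under every probability measure. -/
def UniversallyMeasurable {α β : Type*} [MeasurableSpace α] [MeasurableSpace β]
    (f : α → β) : Prop :=
  ∀ μ : Measure α, IsProbabilityMeasure μ → NullMeasurable f μ

theorem Measurable.universallyMeasurable {α β : Type*} [MeasurableSpace α] [MeasurableSpace β]
    {f : α → β} (hf : Measurable f) : UniversallyMeasurable f :=
  fun _ _ => hf.nullMeasurable

/-! ### General Markov decision processes and control strategies -/

/-- A general Markov decision process with state space `X`, input space `U` and output space `Y`. -/
structure GMDP (X U Y : Type*) [MeasurableSpace X] [MeasurableSpace U] [MeasurableSpace Y] where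
  /-- the initial state `x₀` -/
  init : X
  /-- the controlled stochastic kernel `t(· | x, u)` -/
  trans : Kernel (X × U) X
  markov : IsMarkovKernel trans
  /-- the output map `h` -/
  out : X → Y
  measurable_out : Measurable out

/-- The measure `t(· | x, ν) = ∫ t(· | x, u) ν(du)`: the next state when the input is drawn
from `ν`. -/
def GMDP.transMixed {X U Y : Type*} [MeasurableSpace X] [MeasurableSpace U] [MeasurableSpace Y]
    (M : GMDP X U Y) (x : X) (ν : ProbabilityMeasure U) : Measure X :=
  (ν : Measure U).bind fun u => M.trans (x, u)

/-- A (randomised) stationary Markov policy: the universally measurable map that is used at every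
time step. -/
structure StationaryPolicy (Z U : Type*) [MeasurableSpace Z] [MeasurableSpace U] where
  act : Z → ProbabilityMeasure U
  universallyMeasurable_act : UniversallyMeasurable act

/-- A control strategy for a model with state space `X` and input space `U`. It has a Polish memory
space, it reads states of the model, and it outputs probability measures on the inputs. -/
structure ControlStrategy (X U : Type u) [MeasurableSpace X] [MeasurableSpace U] where
  Mem : Type u
  [topologicalSpace : TopologicalSpace Mem]
  [polishSpace : PolishSpace Mem]
  [measurableSpace : MeasurableSpace Mem]
  [borelSpace : BorelSpace Mem]
  /-- the initial memory state -/
  init : Mem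
  /-- the kernel `t_C(· | c, x)` that updates the memory -/
  trans : Mem × X → ProbabilityMeasure Mem
  universallyMeasurable_trans : UniversallyMeasurable trans
  /-- the output map `h_C` -/
  out : Mem → ProbabilityMeasure U
  universallyMeasurable_out : UniversallyMeasurable out

attribute [instance] ControlStrategy.topologicalSpace ControlStrategy.polishSpace
  ControlStrategy.measurableSpace ControlStrategy.borelSpace

/-- The one-step transition probability of the controlled model `C × M` from `(x, c)` into `B`:
first the memory reads `x` and moves to `c'` with law `t_C(· | c, x)`, then an input `u` is drawn
from `h_C(c')`, then the model moves to `x'` with law `t(· | x, u)`. -/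
def ControlStrategy.stepProb {X U : Type u} {Y : Type*} [MeasurableSpace X] [MeasurableSpace U]
    [MeasurableSpace Y] (C : ControlStrategy X U) (M : GMDP X U Y) (z : X × C.Mem)
    (B : Set (X × C.Mem)) : ℝ≥0∞ :=
  ∫⁻ c', ∫⁻ u, M.trans (z.1, u) {x' | (x', c') ∈ B} ∂(C.out c' : Measure U)
    ∂(C.trans (z.2, z.1) : Measure C.Mem)

/-- `P` is the probability measure of the executions `(x_t, c_t)`, `t = 0, 1, 2, …`, of the
controlled model `C × M`: it starts at the initial states, and given the history up to time `n`
the next pair has the transition probability `stepProb` from the current pair. These conditions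
fix all finite-dimensional distributions, hence determine `P`. -/
structure IsExecutionLaw {X U : Type u} {Y : Type*} [MeasurableSpace X] [MeasurableSpace U]
    [MeasurableSpace Y] (C : ControlStrategy X U) (M : GMDP X U Y)
    (P : Measure (ℕ → X × C.Mem)) : Prop where
  isProbabilityMeasure : IsProbabilityMeasure P
  map_zero : P.map (fun w => w 0) = Measure.dirac (M.init, C.init)
  step : ∀ (n : ℕ) (A : Set (Fin (n + 1) → X × C.Mem)) (B : Set (X × C.Mem)),
    MeasurableSet A → MeasurableSet B →
      P {w | (fun i : Fin (n + 1) => w i) ∈ A ∧ w (n + 1) ∈ B} =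
        ∫⁻ w in {w | (fun i : Fin (n + 1) => w i) ∈ A}, C.stepProb M (w n) B ∂P

/-! ### Syntactically co-safe LTL and automata -/

/-- Syntax of scLTL over the atomic propositions `AP`. -/
inductive ScLTL (AP : Type*) where
  | atom (p : AP) : ScLTL AP
  | natom (p : AP) : ScLTL AP
  | conj (φ ψ : ScLTL AP) : ScLTL AP
  | disj (φ ψ : ScLTL AP) : ScLTL AP
  | next (φ : ScLTL AP) : ScLTL AP
  | untl (φ ψ : ScLTL AP) : ScLTL AP

/-- `φ.SatAt ω t` says that the postfix `ω_t, ω_{t+1}, …` of the word `ω` satisfies `φ`. -/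
def ScLTL.SatAt {AP : Type*} (ω : ℕ → Set AP) : ScLTL AP → ℕ → Prop
  | .atom p, t => p ∈ ω t
  | .natom p, t => p ∉ ω t
  | .conj φ ψ, t => φ.SatAt ω t ∧ ψ.SatAt ω t
  | .disj φ ψ, t => φ.SatAt ω t ∨ ψ.SatAt ω t
  | .next φ, t => φ.SatAt ω (t + 1)
  | .untl φ ψ, t => ∃ i, ψ.SatAt ω (t + i) ∧ ∀ j < i, φ.SatAt ω (t + j)

/-- `ω ⊨ φ`. -/
def ScLTL.Sat {AP : Type*} (φ : ScLTL AP) (ω : ℕ → Set AP) : Prop := φ.SatAt ω 0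

/-- The run of a deterministic automaton on an infinite word. -/
def DFA.run {α Q : Type*} (A : DFA α Q) (ω : ℕ → α) : ℕ → Q
  | 0 => A.start
  | n + 1 => A.step (A.run ω n) (ω n)

/-- An infinite word is accepted if its run visits an accepting location. -/
def DFA.AcceptsWord {α Q : Type*} (A : DFA α Q) (ω : ℕ → α) : Prop :=
  ∃ n, A.run ω n ∈ A.accept

/-- `A` is an automaton `A_ψ` for the formula `ψ`. -/
def DFA.Recognizes {AP Q : Type*} (A : DFA (Set AP) Q) (ψ : ScLTL AP) : Prop :=
  ∀ ω : ℕ → Set AP, ψ.Sat ω ↔ A.AcceptsWord ω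

/-- A measurable labelling function from `Y` to the finite alphabet `Set AP`. -/
structure Labelling (Y AP : Type*) [MeasurableSpace Y] where
  label : Y → Set AP
  measurableSet_fiber : ∀ a : Set AP, MeasurableSet (label ⁻¹' {a})

/-- The execution `w` produces a word that satisfies `ψ`. -/
def ExecutionSat {X U : Type u} {Y AP : Type*} [MeasurableSpace X] [MeasurableSpace U]
    [MeasurableSpace Y] (C : ControlStrategy X U) (M : GMDP X U Y) (L : Labelling Y AP)
    (ψ : ScLTL AP) (w : ℕ → X × C.Mem) : Prop :=
  ψ.Sat fun t => L.label (M.out (w t).1)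

/-- `C × M` satisfies `ψ` with probability at least `p`: the law of the executions exists, and
under it the probability of `ω ⊨ ψ` is at least `p`. -/
def SatisfiesWithProbAtLeast {X U : Type u} {Y AP : Type*} [MeasurableSpace X] [MeasurableSpace U]
    [MeasurableSpace Y] (C : ControlStrategy X U) (M : GMDP X U Y) (L : Labelling Y AP)
    (ψ : ScLTL AP) (p : ℝ≥0∞) : Prop :=
  (∃ P, IsExecutionLaw C M P) ∧
    ∀ P, IsExecutionLaw C M P → p ≤ P {w | ExecutionSat C M L ψ w}

theorem Labelling.measurable_step {Y AP Q : Type*} [MeasurableSpace Y] [Finite AP] [Finite Q]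
    [MeasurableSpace Q] [MeasurableSingletonClass Q] (L : Labelling Y AP) (A : DFA (Set AP) Q) :
    Measurable fun p : Y × Q => A.step p.2 (L.label p.1) := by
  refine measurable_from_prod_countable_left fun q => ?_
  have hL : Measurable[_, ⊤] L.label := by
    let : MeasurableSpace (Set AP) := ⊤
    have : Countable (Set AP) := Finite.to_countable
    exact measurable_to_countable' L.measurableSet_fiber
  let : MeasurableSpace (Set AP) := ⊤
  exact (measurable_from_top (f := fun a => A.step q a)).comp hL

/-- The product `M ⊗ A` of a gMDP and an automaton. -/
def GMDP.prodDFA {X U Y AP Q : Type*} [MeasurableSpace X] [MeasurableSpace U] [MeasurableSpace Y]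
    [Finite AP] [Finite Q] [MeasurableSpace Q] [MeasurableSingletonClass Q]
    (M : GMDP X U Y) (L : Labelling Y AP) (A : DFA (Set AP) Q) : GMDP (X × Q) U Y where
  init := (M.init, A.step A.start (L.label (M.out M.init)))
  trans :=
    { toFun := fun z =>
        (M.trans (z.1.1, z.2)).map fun x' => (x', A.step z.1.2 (L.label (M.out x')))
      measurable' := by
        have := M.markov
        have hstep : Measurable fun p : ((X × Q) × U) × X =>
            ((p.2, A.step p.1.1.2 (L.label (M.out p.2))) : X × Q) :=
          measurable_snd.prodMk ((L.measurable_step A).comp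
            ((M.measurable_out.comp measurable_snd).prodMk
              (measurable_snd.comp (measurable_fst.comp measurable_fst))))
        have hin : Measurable fun z : (X × Q) × U => (z.1.1, z.2) :=
          (measurable_fst.comp measurable_fst).prodMk measurable_snd
        refine Measure.measurable_of_measurable_coe _ fun s hs => ?_
        have key := Kernel.measurable_kernel_prodMk_left (κ := M.trans.comap _ hin) (hstep hs)
        convert key using 2 with z
        exact Measure.map_apply (hstep.comp measurable_prodMk_left) hs }
  markov := ⟨fun z => by
    have := M.markov
    exact Measure.isProbabilityMeasure_map (measurable_id.prodMk ((L.measurable_step A).comp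
      (M.measurable_out.prodMk measurable_const))).aemeasurable⟩
  out := fun z => M.out z.1
  measurable_out := M.measurable_out.comp measurable_fst

/-- The control strategy for `M` that a stationary Markov policy `μ` on `M ⊗ A` induces: the
memory stores the last state and the location of the automaton, and the output is the value of `μ`
there. -/
def StationaryPolicy.toStrategy {X U Q : Type u} {Y AP : Type*}
    [TopologicalSpace X] [PolishSpace X] [MeasurableSpace X] [BorelSpace X]
    [MeasurableSpace U] [MeasurableSpace Y]
    [Finite AP] [Finite Q] [TopologicalSpace Q] [DiscreteTopology Q] [MeasurableSpace Q]
    [BorelSpace Q] (μ : StationaryPolicy (X × Q) U) (M : GMDP X U Y) (L : Labelling Y AP)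
    (A : DFA (Set AP) Q) : ControlStrategy X U where
  Mem := X × Q
  init := (M.init, A.start)
  trans := fun z =>
    ⟨Measure.dirac (z.2, A.step z.1.2 (L.label (M.out z.2))), Measure.dirac.isProbabilityMeasure⟩
  universallyMeasurable_trans := Measurable.universallyMeasurable <|
    Measurable.subtype_mk <| Measure.measurable_dirac.comp <|
      measurable_snd.prodMk ((L.measurable_step A).comp
        ((M.measurable_out.comp measurable_snd).prodMk (measurable_snd.comp measurable_fst)))
  out := μ.act
  universallyMeasurable_out := μ.universallyMeasurable_act

/-! ### Approximate stochastic simulation -/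

/-- `W` is a lifting that witnesses `Δ R̄_δ Θ`. -/
structure IsLifting {X₁ X₂ : Type*} [MeasurableSpace X₁] [MeasurableSpace X₂]
    (R : Set (X₁ × X₂)) (δ : ℝ≥0) (Δ : Measure X₁) (Θ : Measure X₂)
    (W : Measure (X₁ × X₂)) : Prop where
  left : ∀ A, MeasurableSet A → W (A ×ˢ Set.univ) = Δ A
  right : ∀ A, MeasurableSet A → W (Set.univ ×ˢ A) = Θ A
  rel : 1 - (δ : ℝ≥0∞) ≤ W R

/-- The relation `R`, the interface function `Uv` and the kernel `W` show that `Mh` is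
`(ε, δ)`-stochastically simulated by `M`. -/
structure IsStochSimulation {X₁ U₁ X₂ U₂ Y : Type*} [MeasurableSpace X₁] [MeasurableSpace U₁]
    [MeasurableSpace X₂] [MeasurableSpace U₂] [MetricSpace Y] [MeasurableSpace Y]
    (Mh : GMDP X₁ U₁ Y) (M : GMDP X₂ U₂ Y) (ε : ℝ) (δ : ℝ≥0) (R : Set (X₁ × X₂))
    (Uv : U₁ × X₁ × X₂ → ProbabilityMeasure U₂) (W : Kernel (U₁ × X₁ × X₂) (X₁ × X₂)) :
    Prop where
  measurableSet_rel : MeasurableSet R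
  universallyMeasurable_interface : UniversallyMeasurable Uv
  isMarkovKernel : IsMarkovKernel W
  init : (Mh.init, M.init) ∈ R
  dist_out : ∀ x₁ x₂, (x₁, x₂) ∈ R → dist (Mh.out x₁) (M.out x₂) ≤ ε
  lifting : ∀ x₁ x₂, (x₁, x₂) ∈ R → ∀ u₁ : U₁,
    IsLifting R δ (Mh.trans (x₁, u₁)) (M.transMixed x₂ (Uv (u₁, x₁, x₂))) (W (u₁, x₁, x₂))

/-- `Mh ⪯ M` with deviations `(ε, δ)`: `Mh` is `(ε, δ)`-stochastically simulated by `M`. -/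
def StochSimulated {X₁ U₁ X₂ U₂ Y : Type*} [MeasurableSpace X₁] [MeasurableSpace U₁]
    [MeasurableSpace X₂] [MeasurableSpace U₂] [MetricSpace Y] [MeasurableSpace Y]
    (Mh : GMDP X₁ U₁ Y) (M : GMDP X₂ U₂ Y) (ε : ℝ) (δ : ℝ≥0) : Prop :=
  ∃ R Uv W, IsStochSimulation Mh M ε δ R Uv W

/-- The control strategy for `Mh` `(ε, δ)`-robustly satisfies `ψ` with probability `p`: every `M`
that `(ε, δ)`-stochastically simulates `Mh` has a control strategy under which it satisfies `ψ` with
probability at least `p`. As in the standard definition, the strategy for `Mh` does not occur in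
the condition itself. -/
def RobustlySatisfies {X₁ U₁ : Type u} {Y AP : Type*} [MeasurableSpace X₁] [MeasurableSpace U₁]
    [MetricSpace Y] [MeasurableSpace Y] (Mh : GMDP X₁ U₁ Y) (_Ch : ControlStrategy X₁ U₁)
    (L : Labelling Y AP) (ψ : ScLTL AP) (ε : ℝ) (δ : ℝ≥0) (p : ℝ≥0∞) : Prop :=
  ∀ (X U : Type u) [TopologicalSpace X] [PolishSpace X] [MeasurableSpace X] [BorelSpace X]
    [TopologicalSpace U] [PolishSpace U] [MeasurableSpace U] [BorelSpace U] (M : GMDP X U Y),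
    StochSimulated Mh M ε δ →
      ∃ C : ControlStrategy X U, SatisfiesWithProbAtLeast C M L ψ p

/-! ### The robust dynamic programming operator

Value functions take values in `[0, 1] ⊆ ℝ≥0∞`; subtraction in `ℝ≥0∞` is truncated at `0`. -/

section Robust

variable {Z U Y : Type*} [MeasurableSpace Z] [MeasurableSpace U] [MeasurableSpace Y]

/-- The Bellman operator `T^μ (V)(z) = ∫ max {1_G(z'), V(z')} t(dz' | z, μ(z))` of the model `N` for
the target set `G`. -/
def bellman (N : GMDP Z U Y) (G : Set Z) (μ : StationaryPolicy Z U) (V : Z → ℝ≥0∞) (z : Z) :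
    ℝ≥0∞ :=
  ∫⁻ z', max (G.indicator 1 z') (V z') ∂(N.transMixed z (μ.act z))

/-- The `δ`-robust operator `L (T^μ (V) - δ)`, where `L` truncates to `[0, 1]`. -/
def robustBellman (N : GMDP Z U Y) (G : Set Z) (μ : StationaryPolicy Z U) (δ : ℝ≥0)
    (V : Z → ℝ≥0∞) (z : Z) : ℝ≥0∞ :=
  min 1 (bellman N G μ V z - δ)

/-- The limit of the iterates of the `δ`-robust operator from `V₀ = 0`. The iterates increase, so
the limit is their supremum, see `tendsto_robustValue`. -/
def robustValue (N : GMDP Z U Y) (G : Set Z) (μ : StationaryPolicy Z U) (δ : ℝ≥0) (z : Z) :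
    ℝ≥0∞ :=
  ⨆ l : ℕ, (robustBellman N G μ δ)^[l] 0 z

theorem robustBellman_mono (N : GMDP Z U Y) (G : Set Z) (μ : StationaryPolicy Z U) (δ : ℝ≥0) :
    Monotone (robustBellman N G μ δ) := fun _ _ h _ =>
  min_le_min le_rfl (tsub_le_tsub_right
    (lintegral_mono fun z' => max_le_max le_rfl (h z')) _)

theorem tendsto_robustValue (N : GMDP Z U Y) (G : Set Z) (μ : StationaryPolicy Z U) (δ : ℝ≥0)
    (z : Z) :
    Tendsto (fun l => (robustBellman N G μ δ)^[l] 0 z) atTop (𝓝 (robustValue N G μ δ z)) :=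
  tendsto_atTop_iSup fun _ _ h =>
    (robustBellman_mono N G μ δ).monotone_iterate_of_le_map (x := 0) (fun _ => zero_le) h z

end Robust

section RobustSat

variable {X U Y AP Q : Type*} [MeasurableSpace X] [MeasurableSpace U] [MeasurableSpace Y]
  [Finite AP] [Finite Q] [MeasurableSpace Q] [MeasurableSingletonClass Q]

/-- The target set `X × F` of the product `M ⊗ A`. -/
def targetSet (X : Type*) {AP Q : Type*} (A : DFA (Set AP) Q) : Set (X × Q) :=
  {z | z.2 ∈ A.accept}

/-- The `δ`-robust satisfaction probability `max {1_F(q̄₀), V_∞(x₀, q̄₀)}` of a stationary policy on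
the product `M ⊗ A`. -/
def robustSatProb (M : GMDP X U Y) (L : Labelling Y AP) (A : DFA (Set AP) Q)
    (μ : StationaryPolicy (X × Q) U) (δ : ℝ≥0) : ℝ≥0∞ :=
  max ((targetSet X A).indicator 1 (M.prodDFA L A).init)
    (robustValue (M.prodDFA L A) (targetSet X A) μ δ (M.prodDFA L A).init)

end RobustSat

end

set_option linter.unusedSectionVars false

noncomputable section

/-! ### The sigma-algebra on the probability measures -/

/-! Fixed point. The iterates from `0` increase, so monotone convergence moves the supremum through
the integral (`bellman_robustValue`); subtracting `δ` and cutting at `1` also commute with suprema.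

Uniqueness. A solution `V` dominates the least one `W` by monotonicity. Conversely, a bound `V ≤ W +
c (1 - V)` improves to the same bound with `c (1 - δ)` (`le_robustValue_add_of_fixed`): where `V >
0` the integral of the stage value of `V` is exactly `V + δ`, and `1 - V - δ ≤ (1 - δ)(1 - V)`.
Starting from `c = 1/δ` and iterating gives `V ≤ W`.

Robustness. The concrete strategy runs the abstract model in its memory. On reading the concrete
state it samples the abstract state from the simulation kernel conditioned on that concrete state,
draws an abstract input from the policy, and passes it through the interface. Let `H l` be the
expected stage value of the `l`-th iterate under the law of the current abstract state, counted only
on the relation. Labels agree on the relation because `ε = 0`, and the coupling leaves it with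
probability at most `δ`, which is what the robust operator subtracts. So `H` satisfies the Bellman
inequality of the concrete chain without any loss
(`IsStochSimulation.concreteValue_robustBellman_le`), and induction on the horizon bounds `H l` by
the probability of acceptance (`le_measure_reach`). Leaving the relation forfeits all value, so
nothing is required of the strategy afterwards.

Policies and interfaces are only universally measurable. Under any fixed probability law they agree
almost everywhere with Borel maps when the target is countably generated; this yields the integrals
and, with Ionescu-Tulcea, the execution law. -/

theorem exists_countable_piSystem (β : Type*) [m : MeasurableSpace β]
    [MeasurableSpace.CountablyGenerated β] :
    ∃ S : Set (Set β), S.Countable ∧ IsPiSystem S ∧ m = MeasurableSpace.generateFrom S := by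
  obtain ⟨C, hC, hm⟩ := MeasurableSpace.CountablyGenerated.isCountablyGenerated (α := β)
  refine ⟨Set.sInter '' {F | F.Finite ∧ F ⊆ C}, (Set.countable_ofPred_finite_subset hC).image _,
    ?_, le_antisymm ?_ ?_⟩
  · rintro _ ⟨F, ⟨hF, hFC⟩, rfl⟩ _ ⟨G, ⟨hG, hGC⟩, rfl⟩ -
    exact ⟨F ∪ G, ⟨hF.union hG, Set.union_subset hFC hGC⟩, Set.sInter_union F G⟩
  · conv_lhs => rw [hm]
    refine MeasurableSpace.generateFrom_mono fun s hs => ⟨{s}, ⟨Set.finite_singleton s, ?_⟩, ?_⟩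
    · simpa using hs
    · simp
  · refine MeasurableSpace.generateFrom_le ?_
    rintro _ ⟨F, ⟨hF, hFC⟩, rfl⟩
    refine MeasurableSet.sInter hF.countable fun s hs => ?_
    rw [hm]
    exact MeasurableSpace.measurableSet_generateFrom (hFC hs)

/-- A probability measure is determined measurably by its values on a countable generating π-system,
so the sigma-algebra is pulled back from a countable product. Countable generation of the target is
what turns null measurability into a.e. equality with a Borel map. -/
instance MeasureTheory.ProbabilityMeasure.countablyGenerated {β : Type*} [MeasurableSpace β]
    [MeasurableSpace.CountablyGenerated β] :
    MeasurableSpace.CountablyGenerated (ProbabilityMeasure β) := by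
  obtain ⟨S, hS, hpi, hm⟩ := exists_countable_piSystem β
  have : Countable S := hS.to_subtype
  let f : ProbabilityMeasure β → (S → ℝ≥0∞) := fun ν s => (ν : Measure β) s
  have hSm : ∀ s ∈ S, MeasurableSet s := fun s hs => by
    rw [hm]; exact MeasurableSpace.measurableSet_generateFrom hs
  have hf : Measurable f := measurable_pi_lambda _ fun s =>
    (Measure.measurable_coe (hSm s s.2)).comp measurable_subtype_coe
  have hle : ∀ t : Set (ProbabilityMeasure β), MeasurableSet t →
      MeasurableSet[MeasurableSpace.comap f inferInstance] t := by
    have key : @Measurable _ _ (MeasurableSpace.comap f inferInstance) _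
        fun ν : ProbabilityMeasure β => ν := by
      let : MeasurableSpace (ProbabilityMeasure β) := MeasurableSpace.comap f inferInstance
      have hf : Measurable f := comap_measurable f
      have : Measurable fun ν : ProbabilityMeasure β => (ν : Measure β) :=
        Measurable.measure_of_isPiSystem_of_isProbabilityMeasure hm hpi fun s hs =>
          (measurable_pi_apply (⟨s, hs⟩ : S)).comp hf
      exact this.subtype_mk
    exact fun t ht => key ht
  convert! MeasurableSpace.CountablyGenerated.comap (m := inferInstance) f
  exact le_antisymm hle hf.comap_le

/-! ### Calculus of universally measurable maps -/

namespace UniversallyMeasurable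

variable {α β γ : Type*} [MeasurableSpace α] [MeasurableSpace β] [MeasurableSpace γ]

theorem comp_measurable {g : β → γ} {f : α → β} (hg : UniversallyMeasurable g)
    (hf : Measurable f) : UniversallyMeasurable fun a => g (f a) := fun μ _ =>
  (hg (μ.map f) (Measure.isProbabilityMeasure_map hf.aemeasurable)).comp_quasiMeasurePreserving
    (hf.quasiMeasurePreserving μ)

theorem measurable_comp {g : β → γ} {f : α → β} (hg : Measurable g)
    (hf : UniversallyMeasurable f) : UniversallyMeasurable fun a => g (f a) := fun μ hμ _ hs =>
  hf μ hμ (hg hs)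

theorem prodMk {f : α → β} {g : α → γ} (hf : UniversallyMeasurable f)
    (hg : UniversallyMeasurable g) : UniversallyMeasurable fun a => (f a, g a) := fun μ hμ =>
  Measurable.prodMk (hf μ hμ).measurable' (hg μ hμ).measurable'

theorem aemeasurable [MeasurableSpace.CountablyGenerated β] {f : α → β}
    (hf : UniversallyMeasurable f) (μ : Measure α) [IsProbabilityMeasure μ] : AEMeasurable f μ :=
  (hf μ inferInstance).aemeasurable

theorem of_aemeasurable {f : α → β}
    (hf : ∀ (μ : Measure α) [IsProbabilityMeasure μ], AEMeasurable f μ) :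
    UniversallyMeasurable f := fun μ _ => (hf μ).nullMeasurable

theorem max {f g : α → ℝ≥0∞} (hf : UniversallyMeasurable f) (hg : UniversallyMeasurable g) :
    UniversallyMeasurable fun a => max (f a) (g a) :=
  measurable_comp (measurable_fst.max measurable_snd) (hf.prodMk hg)

theorem mul {f g : α → ℝ≥0∞} (hf : UniversallyMeasurable f) (hg : UniversallyMeasurable g) :
    UniversallyMeasurable fun a => f a * g a :=
  measurable_comp (measurable_fst.mul measurable_snd) (hf.prodMk hg)

theorem coe {K : α → ProbabilityMeasure β} (hK : UniversallyMeasurable K) :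
    UniversallyMeasurable fun a => (K a : Measure β) :=
  measurable_comp measurable_subtype_coe hK

theorem of_coe {K : α → ProbabilityMeasure β}
    (hK : ∀ s, MeasurableSet s → UniversallyMeasurable fun a => (K a : Measure β) s) :
    UniversallyMeasurable K := fun μ hμ => by
  -- Over the completed sigma-algebra null measurability is ordinary measurability, so checking
  -- evaluations on sets is enough.
  have : Measurable fun a : NullMeasurableSpace α μ => (K a : Measure β) :=
    Measure.measurable_of_measurable_coe _ fun s hs => (hK s hs μ hμ).measurable'
  exact this.subtype_mk

theorem aemeasurable_coe [MeasurableSpace.CountablyGenerated β] {K : α → ProbabilityMeasure β}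
    (hK : UniversallyMeasurable K) (μ : Measure α) [IsProbabilityMeasure μ] :
    AEMeasurable (fun a => (K a : Measure β)) μ :=
  measurable_subtype_coe.comp_aemeasurable (hK.aemeasurable μ)

/-- A universally measurable stochastic kernel agrees almost everywhere with a Borel one. -/
theorem exists_kernel_ae_eq [MeasurableSpace.CountablyGenerated β] {K : α → ProbabilityMeasure β}
    (hK : UniversallyMeasurable K) (μ : Measure α) [IsProbabilityMeasure μ] :
    ∃ κ : Kernel α β, IsMarkovKernel κ ∧ ∀ᵐ a ∂μ, (K a : Measure β) = κ a := by
  have hm := hK.aemeasurable μ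
  obtain ⟨g, hg, hKg⟩ := hm
  refine ⟨⟨fun a => (g a : Measure β), measurable_subtype_coe.comp hg⟩, ⟨fun a => (g a).2⟩, ?_⟩
  filter_upwards [hKg] with a ha
  rw [ha]; rfl

/-- Fix a law on `α`, replace the kernel by a Borel version `κ` and the integrand by a Borel version
under `μ ⊗ₘ κ`; Fubini for null sets shows that the integral changes only on a null set. -/
theorem lintegral [MeasurableSpace.CountablyGenerated β] {K : α → ProbabilityMeasure β}
    (hK : UniversallyMeasurable K) {f : α × β → ℝ≥0∞} (hf : UniversallyMeasurable f) :
    UniversallyMeasurable fun a => ∫⁻ b, f (a, b) ∂(K a : Measure β) := by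
  refine of_aemeasurable fun μ _ => ?_
  obtain ⟨κ, _, hκ⟩ := hK.exists_kernel_ae_eq μ
  have hf' := hf.aemeasurable (μ ⊗ₘ κ)
  refine ⟨fun a => ∫⁻ b, hf'.mk f (a, b) ∂κ a,
    Measurable.lintegral_kernel_prod_right (f := fun a b => hf'.mk f (a, b)) hf'.measurable_mk, ?_⟩
  filter_upwards [hκ, Measure.ae_ae_of_ae_compProd hf'.ae_eq_mk] with a ha hfa
  rw [ha]
  exact lintegral_congr_ae hfa

end UniversallyMeasurable

/-! ### Composition of universally measurable stochastic kernels -/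

section Bind

variable {α β γ : Type*} [MeasurableSpace α] [MeasurableSpace β] [MeasurableSpace γ]
  [MeasurableSpace.CountablyGenerated γ]

/-- Draw `b` from `ν`, then draw from `J b`. -/
def MeasureTheory.ProbabilityMeasure.univBind (ν : ProbabilityMeasure β) (J : β → ProbabilityMeasure γ)
    (hJ : UniversallyMeasurable J) : ProbabilityMeasure γ :=
  ⟨(ν : Measure β).bind fun b => (J b : Measure γ), ⟨by
    rw [Measure.bind_apply MeasurableSet.univ (hJ.aemeasurable_coe _)]
    simp⟩⟩

variable {ν : ProbabilityMeasure β} {J : β → ProbabilityMeasure γ}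

theorem MeasureTheory.ProbabilityMeasure.univBind_apply (hJ : UniversallyMeasurable J) {s : Set γ}
    (hs : MeasurableSet s) :
    (ν.univBind J hJ : Measure γ) s = ∫⁻ b, (J b : Measure γ) s ∂(ν : Measure β) :=
  Measure.bind_apply hs (hJ.aemeasurable_coe _)

theorem MeasureTheory.ProbabilityMeasure.lintegral_univBind (hJ : UniversallyMeasurable J) {f : γ → ℝ≥0∞}
    (hf : UniversallyMeasurable f) :
    ∫⁻ c, f c ∂(ν.univBind J hJ : Measure γ) =
      ∫⁻ b, ∫⁻ c, f c ∂(J b : Measure γ) ∂(ν : Measure β) :=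
  Measure.lintegral_bind (hJ.aemeasurable_coe _) (hf.aemeasurable (ν.univBind J hJ : Measure γ))

theorem UniversallyMeasurable.univBind [MeasurableSpace.CountablyGenerated β]
    {K : α → ProbabilityMeasure β} (hK : UniversallyMeasurable K)
    {J : α × β → ProbabilityMeasure γ} (hJ : UniversallyMeasurable J) :
    UniversallyMeasurable fun a =>
      (K a).univBind (fun b => J (a, b)) (hJ.comp_measurable measurable_prodMk_left) := by
  refine of_coe fun s hs => ?_
  simp_rw [ProbabilityMeasure.univBind_apply _ hs]
  exact hK.lintegral (measurable_comp (Measure.measurable_coe hs) hJ.coe)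

end Bind

/-! ### The mixed transition law -/

section TransMixed

variable {X U Y : Type*} [MeasurableSpace X] [MeasurableSpace U] [MeasurableSpace Y]

theorem GMDP.measurable_trans_section (M : GMDP X U Y) (x : X) :
    Measurable fun u => M.trans (x, u) :=
  M.trans.measurable.comp measurable_prodMk_left

instance GMDP.isProbabilityMeasure_trans (M : GMDP X U Y) (z : X × U) :
    IsProbabilityMeasure (M.trans z) := M.markov.isProbabilityMeasure z

theorem GMDP.transMixed_apply (M : GMDP X U Y) (x : X) (ν : ProbabilityMeasure U) {s : Set X}
    (hs : MeasurableSet s) : M.transMixed x ν s = ∫⁻ u, M.trans (x, u) s ∂(ν : Measure U) :=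
  Measure.bind_apply hs (M.measurable_trans_section x).aemeasurable

instance GMDP.isProbabilityMeasure_transMixed (M : GMDP X U Y) (x : X) (ν : ProbabilityMeasure U) :
    IsProbabilityMeasure (M.transMixed x ν) := ⟨by
  simp [M.transMixed_apply x ν MeasurableSet.univ]⟩

theorem GMDP.lintegral_transMixed (M : GMDP X U Y) (x : X) (ν : ProbabilityMeasure U)
    {f : X → ℝ≥0∞} (hf : UniversallyMeasurable f) :
    ∫⁻ x', f x' ∂(M.transMixed x ν) = ∫⁻ u, ∫⁻ x', f x' ∂(M.trans (x, u)) ∂(ν : Measure U) :=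
  Measure.lintegral_bind (M.measurable_trans_section x).aemeasurable
    (hf.aemeasurable (M.transMixed x ν))

/-- The transition kernel as a map into the probability measures. -/
def GMDP.transProb (M : GMDP X U Y) (z : X × U) : ProbabilityMeasure X :=
  ⟨M.trans z, inferInstance⟩

theorem GMDP.measurable_transProb (M : GMDP X U Y) : Measurable M.transProb :=
  M.trans.measurable.subtype_mk

end TransMixed

/-! ### The fixed point equation -/

theorem indicator_one_le_one {Z : Type*} (G : Set Z) (z : Z) : G.indicator (1 : Z → ℝ≥0∞) z ≤ 1 :=
  Set.indicator_le_self' (by simp) z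

section Robust

variable {Z U Y : Type*} [MeasurableSpace Z] [MeasurableSpace U] [MeasurableSpace Y]
  {N : GMDP Z U Y} {G : Set Z} {μ : StationaryPolicy Z U} {δ : ℝ≥0} {V : Z → ℝ≥0∞}

theorem universallyMeasurable_stageValue (hG : MeasurableSet G) (hV : UniversallyMeasurable V) :
    UniversallyMeasurable fun z => max (G.indicator (1 : Z → ℝ≥0∞) z) (V z) :=
  .max (measurable_one.indicator hG).universallyMeasurable hV

theorem robustBellman_le_one (z : Z) : robustBellman N G μ δ V z ≤ 1 := min_le_left _ _

theorem robustIterate_le_one (l : ℕ) (z : Z) : (robustBellman N G μ δ)^[l] 0 z ≤ 1 := by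
  cases l with
  | zero => simp
  | succ l => rw [Function.iterate_succ_apply']; exact robustBellman_le_one z

theorem monotone_robustIterate : Monotone fun l => (robustBellman N G μ δ)^[l] 0 :=
  (robustBellman_mono N G μ δ).monotone_iterate_of_le_map (x := 0) fun _ => zero_le

theorem bellman_le_one (hV : ∀ z, V z ≤ 1) (z : Z) : bellman N G μ V z ≤ 1 := by
  refine (lintegral_mono (g := fun _ => 1) fun z' => ?_).trans (by simp)
  exact max_le (indicator_one_le_one G z') (hV z')

theorem robustValue_le_one (z : Z) : robustValue N G μ δ z ≤ 1 :=
  iSup_le fun l => robustIterate_le_one l z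

variable [MeasurableSpace.CountablyGenerated Z] [MeasurableSpace.CountablyGenerated U]

theorem universallyMeasurable_bellman (hG : MeasurableSet G) (hV : UniversallyMeasurable V) :
    UniversallyMeasurable (bellman N G μ V) := by
  have hm := universallyMeasurable_stageValue hG hV
  have : bellman N G μ V = fun z => ∫⁻ u, ∫⁻ z', max (G.indicator 1 z') (V z')
      ∂(N.transProb (z, u) : Measure Z) ∂(μ.act z : Measure U) :=
    funext fun z => N.lintegral_transMixed z (μ.act z) hm
  rw [this]
  exact μ.universallyMeasurable_act.lintegral
    (N.measurable_transProb.universallyMeasurable.lintegral (hm.comp_measurable measurable_snd))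

theorem universallyMeasurable_robustBellman (hG : MeasurableSet G)
    (hV : UniversallyMeasurable V) : UniversallyMeasurable (robustBellman N G μ δ V) :=
  .measurable_comp (g := fun a => min 1 (a - (δ : ℝ≥0∞))) (by fun_prop)
    (universallyMeasurable_bellman hG hV)

theorem universallyMeasurable_robustIterate (hG : MeasurableSet G) (l : ℕ) :
    UniversallyMeasurable ((robustBellman N G μ δ)^[l] 0) := by
  induction l with
  | zero => exact measurable_zero.universallyMeasurable
  | succ l ih =>
    rw [Function.iterate_succ_apply']
    exact universallyMeasurable_robustBellman hG ih

theorem bellman_robustValue (hG : MeasurableSet G) (z : Z) :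
    bellman N G μ (robustValue N G μ δ) z =
      ⨆ l, bellman N G μ ((robustBellman N G μ δ)^[l] 0) z := by
  unfold bellman
  rw [← lintegral_iSup']
  · refine lintegral_congr fun z' => ?_
    rw [robustValue, sup_iSup]
  · exact fun l => (universallyMeasurable_stageValue hG
      (universallyMeasurable_robustIterate hG l)).aemeasurable _
  · exact ae_of_all _ fun z' l l' h => max_le_max le_rfl (monotone_robustIterate h z')

theorem robustBellman_robustValue (hG : MeasurableSet G) :
    robustBellman N G μ δ (robustValue N G μ δ) = robustValue N G μ δ := by
  funext z
  have hmono : Monotone fun l => (robustBellman N G μ δ)^[l] 0 z :=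
    fun l l' h => monotone_robustIterate h z
  unfold robustBellman
  -- The index shift by one is harmless because the iterates increase.
  rw [bellman_robustValue hG, ENNReal.iSup_sub, inf_iSup_eq, robustValue, ← hmono.iSup_nat_add 1]
  exact iSup_congr fun l => by rw [Function.iterate_succ_apply']; rfl

/-- The contraction estimate behind uniqueness: the factor `1 - V` absorbs the decrease `δ`. -/
theorem le_robustValue_add_of_fixed (hG : MeasurableSet G) (hV : UniversallyMeasurable V)
    (hfix : robustBellman N G μ δ V = V) {c : ℝ≥0∞} (hc : c ≠ ∞)
    (hVc : ∀ z, V z ≤ robustValue N G μ δ z + c * (1 - V z)) (z : Z) :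
    V z ≤ robustValue N G μ δ z + c * (1 - δ) * (1 - V z) := by
  set W := robustValue N G μ δ with hW
  have hV1 : ∀ z, V z ≤ 1 := fun z => hfix ▸ robustBellman_le_one z
  have hWfix : robustBellman N G μ δ W = W := robustBellman_robustValue hG
  rcases eq_or_ne (V z) 0 with h0 | h0
  · simp [h0]
  -- Since `V z ≠ 0`, neither truncation is active at `z`. For `W` only an inequality is needed.
  have hbV : bellman N G μ V z = V z + δ := by
    have h1 : V z = bellman N G μ V z - δ := by
      conv_lhs => rw [← hfix]
      exact min_eq_right (tsub_le_self.trans (bellman_le_one hV1 z))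
    rw [h1, tsub_add_cancel_of_le]
    by_contra h
    exact h0 (h1.trans (tsub_eq_zero_of_le (not_le.1 h).le))
  have hbW : bellman N G μ W z ≤ W z + δ := by
    have h1 : W z = bellman N G μ W z - δ := by
      conv_lhs => rw [← hWfix]
      exact min_eq_right (tsub_le_self.trans (bellman_le_one robustValue_le_one z))
    rw [h1]
    exact le_tsub_add
  have hm := universallyMeasurable_stageValue hG hV
  -- Integrate the assumed bound over the next state; on `G` it is trivial, as the stage value of
  -- `W` is already at least `1`.
  have hint : bellman N G μ V z ≤ bellman N G μ W z + c * (1 - bellman N G μ V z) := by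
    calc bellman N G μ V z
        ≤ ∫⁻ z', (max (G.indicator 1 z') (W z') + c * (1 - max (G.indicator 1 z') (V z')))
            ∂(N.transMixed z (μ.act z)) := by
          refine lintegral_mono fun z' => ?_
          by_cases hz : z' ∈ G
          · simp only [Set.indicator_of_mem hz, Pi.one_apply, max_eq_left (hV1 z')]
            exact (le_max_left _ _).trans le_self_add
          · simpa [Set.indicator_of_notMem hz] using hVc z'
      _ = bellman N G μ W z + c * (1 - bellman N G μ V z) := by
          rw [lintegral_add_right', lintegral_const_mul' _ _ hc, lintegral_sub' (hm.aemeasurable _)]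
          · simp [bellman]
          · exact ((bellman_le_one hV1 z).trans_lt ENNReal.one_lt_top).ne
          · exact ae_of_all _ fun z' => max_le (indicator_one_le_one G z') (hV1 z')
          · exact (((hm.aemeasurable _).const_sub 1).const_mul c)
  rw [hbV] at hint
  have hle : V z + δ ≤ 1 := hbV ▸ bellman_le_one hV1 z
  -- The two sides differ by `δ * V z`.
  have hkey : 1 - (V z + δ) ≤ (1 - (δ : ℝ≥0∞)) * (1 - V z) := by
    lift V z to ℝ≥0 using ((hV1 z).trans_lt ENNReal.one_lt_top).ne with v
    norm_cast at hle ⊢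
    rw [← NNReal.coe_le_coe, NNReal.coe_sub hle, NNReal.coe_mul,
      NNReal.coe_sub (le_of_add_le_right hle), NNReal.coe_sub (le_of_add_le_left hle)]
    push_cast
    nlinarith [mul_nonneg v.2 δ.2, v.coe_nonneg, δ.coe_nonneg]
  have : V z + δ ≤ (W z + c * (1 - δ) * (1 - V z)) + δ :=
    calc V z + δ ≤ W z + δ + c * ((1 - δ) * (1 - V z)) := by
          exact hint.trans (add_le_add hbW (by gcongr))
      _ = _ := by ring
  exact (ENNReal.add_le_add_iff_right ENNReal.coe_ne_top).1 this

/-- Positivity of `δ` serves twice: it keeps every solution below `1 - δ`, which makes the initial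
constant `1/δ` admissible, and it makes the powers of `1 - δ` vanish. -/
theorem eq_robustValue_of_fixed (hG : MeasurableSet G) (hδ : 0 < δ)
    (hV : UniversallyMeasurable V) (hfix : robustBellman N G μ δ V = V) :
    V = robustValue N G μ δ := by
  have hV1 : ∀ z, V z ≤ 1 := fun z => hfix ▸ robustBellman_le_one z
  have hVδ : ∀ z, V z ≤ 1 - δ := fun z => by
    conv_lhs => rw [← hfix]
    exact (min_le_right _ _).trans (tsub_le_tsub_right (bellman_le_one hV1 z) _)
  refine le_antisymm ?_ ?_
  · have hδ0 : (δ : ℝ≥0∞) ≠ 0 := by exact_mod_cast hδ.ne'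
    have hpow : ∀ n : ℕ, ∀ z,
        V z ≤ robustValue N G μ δ z + ((δ : ℝ≥0∞)⁻¹ * (1 - δ) ^ n) * (1 - V z) := by
      intro n
      induction n with
      | zero =>
        intro z
        rcases le_total (δ : ℝ≥0∞) 1 with h1 | h1
        · have : (δ : ℝ≥0∞) ≤ 1 - V z := by
            refine ENNReal.le_sub_of_add_le_left ((hV1 z).trans_lt ENNReal.one_lt_top).ne ?_
            calc V z + δ ≤ (1 - δ) + δ := by gcongr; exact hVδ z
              _ = 1 := tsub_add_cancel_of_le h1
          calc V z ≤ 1 := hV1 z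
            _ = (δ : ℝ≥0∞)⁻¹ * δ := (ENNReal.inv_mul_cancel hδ0 ENNReal.coe_ne_top).symm
            _ ≤ (δ : ℝ≥0∞)⁻¹ * (1 - δ) ^ 0 * (1 - V z) := by rw [pow_zero, mul_one]; gcongr
            _ ≤ _ := le_add_self
        -- For `δ ≥ 1` truncated subtraction forces `V = 0`.
        · exact (hVδ z).trans (by rw [tsub_eq_zero_of_le h1]; exact zero_le)
      | succ n ih =>
        intro z
        refine (le_robustValue_add_of_fixed hG hV hfix ?_ ih z).trans (le_of_eq ?_)
        · exact ENNReal.mul_ne_top (ENNReal.inv_ne_top.2 hδ0)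
            (ENNReal.pow_ne_top (ENNReal.sub_ne_top ENNReal.one_ne_top))
        · rw [pow_succ]; ring
    intro z
    have hlim : Tendsto (fun n : ℕ => robustValue N G μ δ z + (δ : ℝ≥0∞)⁻¹ * (1 - δ) ^ n) atTop
        (𝓝 (robustValue N G μ δ z + (δ : ℝ≥0∞)⁻¹ * 0)) := by
      refine tendsto_const_nhds.add (ENNReal.Tendsto.const_mul ?_
        (Or.inr (ENNReal.inv_ne_top.2 hδ0)))
      exact ENNReal.tendsto_pow_atTop_nhds_zero_of_lt_one
        (ENNReal.sub_lt_self ENNReal.one_ne_top one_ne_zero hδ0)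
    rw [mul_zero, add_zero] at hlim
    exact ge_of_tendsto' hlim fun n => (hpow n z).trans
      (add_le_add le_rfl (mul_le_of_le_one_right' tsub_le_self))
  · intro z
    refine iSup_le fun l => ?_
    have : (robustBellman N G μ δ)^[l] 0 ≤ (robustBellman N G μ δ)^[l] V :=
      (robustBellman_mono N G μ δ).iterate l fun _ => zero_le
    rw [Function.iterate_fixed hfix] at this
    exact this z

end Robust

/-! ### Markov chains with universally measurable transition probabilities -/

section Chain

variable {Z : Type*} [MeasurableSpace Z] [MeasurableSpace.CountablyGenerated Z]
  {S : Z → ProbabilityMeasure Z}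

/-- A Borel version of `S` for the law `ν`. -/
def UniversallyMeasurable.version (hS : UniversallyMeasurable S) (ν : ProbabilityMeasure Z) :
    Kernel Z Z :=
  (hS.exists_kernel_ae_eq (ν : Measure Z)).choose

instance UniversallyMeasurable.isMarkovKernel_version (hS : UniversallyMeasurable S)
    (ν : ProbabilityMeasure Z) : IsMarkovKernel (hS.version ν) :=
  (hS.exists_kernel_ae_eq (ν : Measure Z)).choose_spec.1

theorem UniversallyMeasurable.ae_eq_version (hS : UniversallyMeasurable S)
    (ν : ProbabilityMeasure Z) : ∀ᵐ z ∂(ν : Measure Z), (S z : Measure Z) = hS.version ν z :=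
  (hS.exists_kernel_ae_eq (ν : Measure Z)).choose_spec.2

/-- The law at time `n` of the chain with transition probabilities `S` that starts at `z₀`. -/
def UniversallyMeasurable.marginal (hS : UniversallyMeasurable S) (z₀ : Z) :
    ℕ → ProbabilityMeasure Z
  | 0 => ⟨Measure.dirac z₀, inferInstance⟩
  -- The Borel version used at time `n` depends on the law at time `n`, so versions and laws are
  -- built together.
  | n + 1 => ⟨(hS.version (hS.marginal z₀ n)) ∘ₘ (hS.marginal z₀ n : Measure Z), inferInstance⟩

/-- Ionescu-Tulcea applies to the Borel versions. Each differs from `S` only on a null set of the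
law at its own time, so the step identity holds for `S` itself. -/
theorem UniversallyMeasurable.exists_chain (hS : UniversallyMeasurable S) (z₀ : Z) :
    ∃ P : Measure (ℕ → Z), IsProbabilityMeasure P ∧ P.map (fun w => w 0) = Measure.dirac z₀ ∧
      ∀ (n : ℕ) (A : Set (Fin (n + 1) → Z)) (B : Set Z), MeasurableSet A → MeasurableSet B →
        P {w | (fun i : Fin (n + 1) => w i) ∈ A ∧ w (n + 1) ∈ B} =
          ∫⁻ w in {w | (fun i : Fin (n + 1) => w i) ∈ A}, (S (w n) : Measure Z) B ∂P := by
  let last (n : ℕ) : ((i : Finset.Iic n) → Z) → Z := fun h => h ⟨n, Finset.mem_Iic.2 le_rfl⟩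
  have hlast (n : ℕ) : Measurable (last n) := measurable_pi_apply _
  let κ : (n : ℕ) → Kernel ((i : Finset.Iic n) → Z) Z := fun n =>
    (hS.version (hS.marginal z₀ n)).comap (last n) (hlast n)
  have hκ (n : ℕ) : IsMarkovKernel (κ n) := by infer_instance
  let P : Measure (ℕ → Z) := Kernel.trajMeasure (X := fun _ => Z) (Measure.dirac z₀) κ
  have hstep (n : ℕ) : P.map (Preorder.frestrictLe (π := fun _ => Z) n) ⊗ₘ κ n =
      P.map fun w => (Preorder.frestrictLe (π := fun _ => Z) n w, w (n + 1)) :=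
    Kernel.map_frestrictLe_trajMeasure_compProd_eq_map_trajMeasure
  have hP : IsProbabilityMeasure P :=
    inferInstanceAs (IsProbabilityMeasure (Kernel.trajMeasure (X := fun _ => Z) _ κ))
  have hfr (n : ℕ) : Measurable (Preorder.frestrictLe (π := fun _ : ℕ => Z) n) :=
    Preorder.measurable_frestrictLe n
  have hzero : P.map (fun w => w 0) = Measure.dirac z₀ := by
    let x₀ : (i : Finset.Iic 0) → Z := (MeasurableEquiv.piUnique fun _ : Finset.Iic 0 => Z).symm z₀
    have hP0 : P = Kernel.traj (X := fun _ => Z) κ 0 x₀ := by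
      change (Kernel.traj (X := fun _ => Z) κ 0) ∘ₘ _ = _
      rw [Measure.map_dirac' (MeasurableEquiv.measurable _),
        Measure.dirac_bind (Kernel.measurable _)]
    have hcomp : (fun w : ℕ → Z => w 0) = last 0 ∘ Preorder.frestrictLe (π := fun _ => Z) 0 := rfl
    rw [hcomp, ← Measure.map_map (hlast 0) (hfr 0), hP0, Kernel.traj_map_frestrictLe_apply,
      Kernel.partialTraj_self, Kernel.id_apply, Measure.map_dirac' (hlast 0)]
    rfl
  have hrect (n : ℕ) (A : Set ((i : Finset.Iic n) → Z)) (B : Set Z) (hA : MeasurableSet A)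
      (hB : MeasurableSet B) : P {w | Preorder.frestrictLe (π := fun _ => Z) n w ∈ A ∧
        w (n + 1) ∈ B} = ∫⁻ w in {w | Preorder.frestrictLe (π := fun _ => Z) n w ∈ A},
          hS.version (hS.marginal z₀ n) (w n) B ∂P := by
    have h1 : P {w | Preorder.frestrictLe (π := fun _ => Z) n w ∈ A ∧ w (n + 1) ∈ B} =
        P.map (fun w => (Preorder.frestrictLe (π := fun _ => Z) n w, w (n + 1))) (A ×ˢ B) :=
      (Measure.map_apply ((hfr n).prodMk (measurable_pi_apply _)) (hA.prod hB)).symm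
    rw [h1, ← hstep, Measure.compProd_apply_prod hA hB,
      setLIntegral_map hA ((κ n).measurable_coe hB) (hfr n)]
    rfl
  -- The laws used to choose the versions are the actual time marginals of `P`.
  have hmarg (n : ℕ) : P.map (fun w => w n) = (hS.marginal z₀ n : Measure Z) := by
    induction n with
    | zero => exact hzero
    | succ n ih =>
      ext B hB
      have h2 := hrect n Set.univ B MeasurableSet.univ hB
      simp only [Set.mem_univ, true_and, Set.ofPred_true, Measure.restrict_univ] at h2
      rw [Measure.map_apply (measurable_pi_apply _) hB]
      refine h2.trans ?_
      rw [← lintegral_map (μ := P) (g := fun w : ℕ → Z => w n)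
        ((hS.version (hS.marginal z₀ n)).measurable_coe hB) (measurable_pi_apply _), ih]
      exact (Measure.bind_apply hB (Kernel.aemeasurable _)).symm
  refine ⟨P, hP, hzero, fun n A B hA hB => ?_⟩
  have hg : Measurable fun (h : (i : Finset.Iic n) → Z) (i : Fin (n + 1)) =>
      h ⟨i, Finset.mem_Iic.2 (Nat.lt_succ_iff.1 i.2)⟩ :=
    measurable_pi_lambda _ fun i => measurable_pi_apply _
  refine (hrect n _ B (hg hA) hB).trans (lintegral_congr_ae (ae_restrict_of_ae ?_))
  have := hS.ae_eq_version (hS.marginal z₀ n)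
  rw [← hmarg n] at this
  filter_upwards [ae_of_ae_map (measurable_pi_apply n).aemeasurable this] with w hw
  rw [hw]

theorem UniversallyMeasurable.setLIntegral_succ (hS : UniversallyMeasurable S)
    {P : Measure (ℕ → Z)} [IsProbabilityMeasure P] {n : ℕ} {A : Set (Fin (n + 1) → Z)}
    (hA : MeasurableSet A)
    (hstep : ∀ B : Set Z, MeasurableSet B →
      P {w | (fun i : Fin (n + 1) => w i) ∈ A ∧ w (n + 1) ∈ B} =
        ∫⁻ w in {w | (fun i : Fin (n + 1) => w i) ∈ A}, (S (w n) : Measure Z) B ∂P)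
    {f : Z → ℝ≥0∞} (hf : UniversallyMeasurable f) :
    ∫⁻ w in {w | (fun i : Fin (n + 1) => w i) ∈ A}, f (w (n + 1)) ∂P =
      ∫⁻ w in {w | (fun i : Fin (n + 1) => w i) ∈ A}, ∫⁻ z', f z' ∂(S (w n) : Measure Z) ∂P := by
  have hE : MeasurableSet {w : ℕ → Z | (fun i : Fin (n + 1) => w i) ∈ A} :=
    (measurable_pi_lambda _ fun i => measurable_pi_apply _ :
      Measurable fun (w : ℕ → Z) (i : Fin (n + 1)) => w i) hA
  obtain ⟨E, hEA⟩ : ∃ E, E = {w : ℕ → Z | (fun i : Fin (n + 1) => w i) ∈ A} := ⟨_, rfl⟩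
  rw [← hEA] at hE ⊢
  have hm (k : ℕ) : Measurable fun w : ℕ → Z => w k := measurable_pi_apply k
  have hprob (k : ℕ) : IsProbabilityMeasure (P.map fun w => w k) :=
    Measure.isProbabilityMeasure_map (hm k).aemeasurable
  have hSn : AEMeasurable (fun w => (S (w n) : Measure Z)) (P.restrict E) := by
    have h := hS.aemeasurable_coe (P.map fun w : ℕ → Z => w n)
    exact (h.comp_aemeasurable (hm n).aemeasurable).restrict
  -- The step identity on sets says that these measures agree; integrals of universally measurable
  -- functions follow.
  have hbind : (P.restrict E).map (fun w => w (n + 1)) =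
      (P.restrict E).bind fun w => (S (w n) : Measure Z) := by
    ext B hB
    rw [Measure.map_apply (hm _) hB, Measure.restrict_apply (hm _ hB), Measure.bind_apply hB hSn,
      hEA, ← hstep B hB]
    congr 1
    ext w
    exact and_comm
  have hfm : AEMeasurable f ((P.restrict E).map fun w => w (n + 1)) :=
    (hf.aemeasurable (P.map fun w => w (n + 1))).mono_measure
      (Measure.map_mono Measure.restrict_le_self (hm _))
  rw [← lintegral_map' hfm (hm _).aemeasurable, hbind]
  exact Measure.lintegral_bind hSn (hbind ▸ hfm)

end Chain

/-! ### The step law of the controlled model -/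

section StepLaw

variable {X U : Type u} {Y : Type*} [MeasurableSpace X] [MeasurableSpace U] [MeasurableSpace Y]

/-- The law of `(x', c')` when the model is in `x`, the memory is `c'` and the input is `u`. -/
def GMDP.pairLaw {Mem : Type*} [MeasurableSpace Mem] (M : GMDP X U Y) (p : (X × Mem) × U) :
    ProbabilityMeasure (X × Mem) :=
  ⟨(M.trans (p.1.1, p.2)).map fun x' => (x', p.1.2),
    Measure.isProbabilityMeasure_map measurable_prodMk_right.aemeasurable⟩

theorem GMDP.measurable_pairLaw {Mem : Type*} [MeasurableSpace Mem] (M : GMDP X U Y) :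
    Measurable (M.pairLaw (Mem := Mem)) := by
  refine Measurable.subtype_mk (Measure.measurable_of_measurable_coe _ fun s hs => ?_)
  simp_rw [Measure.map_apply measurable_prodMk_right hs]
  have := M.markov
  exact Kernel.measurable_kernel_prodMk_left
    (κ := M.trans.comap (fun p : (X × Mem) × U => (p.1.1, p.2)) (by fun_prop))
    (t := {q : ((X × Mem) × U) × X | (q.2, q.1.1.2) ∈ s})
    ((by fun_prop : Measurable fun q : ((X × Mem) × U) × X => (q.2, q.1.1.2)) hs)

variable [MeasurableSpace.CountablyGenerated X] [MeasurableSpace.CountablyGenerated U]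

theorem ControlStrategy.universallyMeasurable_inputLaw (C : ControlStrategy X U) (M : GMDP X U Y) :
    UniversallyMeasurable fun p : X × C.Mem => (C.out p.2).univBind (fun u => M.pairLaw (p, u))
      (M.measurable_pairLaw.universallyMeasurable.comp_measurable measurable_prodMk_left) :=
  (C.universallyMeasurable_out.comp_measurable measurable_snd).univBind
    M.measurable_pairLaw.universallyMeasurable

/-- The one-step law of the controlled model as a map into the probability measures. -/
def ControlStrategy.stepLaw (C : ControlStrategy X U) (M : GMDP X U Y) (z : X × C.Mem) :
    ProbabilityMeasure (X × C.Mem) :=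
  (C.trans (z.2, z.1)).univBind (fun c' => (C.out c').univBind (fun u => M.pairLaw ((z.1, c'), u))
      (M.measurable_pairLaw.universallyMeasurable.comp_measurable measurable_prodMk_left))
    ((C.universallyMeasurable_inputLaw M).comp_measurable
      (measurable_prodMk_left (x := z.1)))

theorem ControlStrategy.universallyMeasurable_stepLaw (C : ControlStrategy X U)
    (M : GMDP X U Y) : UniversallyMeasurable (C.stepLaw M) :=
  (C.universallyMeasurable_trans.comp_measurable measurable_swap).univBind
    ((C.universallyMeasurable_inputLaw M).comp_measurable
      (f := fun q : (X × C.Mem) × C.Mem => (q.1.1, q.2)) (by fun_prop))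

theorem ControlStrategy.lintegral_stepLaw (C : ControlStrategy X U) (M : GMDP X U Y)
    (z : X × C.Mem) {f : X × C.Mem → ℝ≥0∞} (hf : UniversallyMeasurable f) :
    ∫⁻ z', f z' ∂(C.stepLaw M z : Measure (X × C.Mem)) =
      ∫⁻ c', ∫⁻ x', f (x', c') ∂(M.transMixed z.1 (C.out c'))
        ∂(C.trans (z.2, z.1) : Measure C.Mem) := by
  rw [stepLaw, ProbabilityMeasure.lintegral_univBind _ hf]
  refine lintegral_congr fun c' => ?_
  rw [ProbabilityMeasure.lintegral_univBind _ hf, M.lintegral_transMixed _ _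
    (hf.comp_measurable measurable_prodMk_right)]
  refine lintegral_congr fun u => ?_
  exact lintegral_map' (hf.aemeasurable (M.pairLaw ((z.1, c'), u) : Measure (X × C.Mem)))
    measurable_prodMk_right.aemeasurable

theorem ControlStrategy.stepLaw_apply (C : ControlStrategy X U) (M : GMDP X U Y)
    (z : X × C.Mem) {B : Set (X × C.Mem)} (hB : MeasurableSet B) :
    (C.stepLaw M z : Measure (X × C.Mem)) B = C.stepProb M z B := by
  rw [stepLaw, ProbabilityMeasure.univBind_apply _ hB, stepProb]
  refine lintegral_congr fun c' => ?_
  rw [ProbabilityMeasure.univBind_apply _ hB]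
  exact lintegral_congr fun u => Measure.map_apply measurable_prodMk_right hB

theorem exists_isExecutionLaw (C : ControlStrategy X U) (M : GMDP X U Y) :
    ∃ P, IsExecutionLaw C M P := by
  obtain ⟨P, hP, h0, hs⟩ :=
    (C.universallyMeasurable_stepLaw M).exists_chain (M.init, C.init)
  refine ⟨P, hP, h0, fun n A B hA hB => ?_⟩
  simp_rw [← C.stepLaw_apply M _ hB]
  exact hs n A B hA hB

theorem IsExecutionLaw.setLIntegral_succ {C : ControlStrategy X U} {M : GMDP X U Y}
    {P : Measure (ℕ → X × C.Mem)} (hP : IsExecutionLaw C M P) (n : ℕ)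
    {A : Set (Fin (n + 1) → X × C.Mem)} (hA : MeasurableSet A) {f : X × C.Mem → ℝ≥0∞}
    (hf : UniversallyMeasurable f) :
    ∫⁻ w in {w | (fun i : Fin (n + 1) => w i) ∈ A}, f (w (n + 1)) ∂P =
      ∫⁻ w in {w | (fun i : Fin (n + 1) => w i) ∈ A},
        ∫⁻ z', f z' ∂(C.stepLaw M (w n) : Measure (X × C.Mem)) ∂P := by
  have := hP.isProbabilityMeasure
  refine (C.universallyMeasurable_stepLaw M).setLIntegral_succ hA (fun B hB => ?_) hf
  simp_rw [C.stepLaw_apply M _ hB]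
  exact hP.step n A B hA hB

end StepLaw

/-! ### Lower bounds for reachability probabilities -/

section Reach

variable {Z : Type*} [MeasurableSpace Z] [MeasurableSpace.CountablyGenerated Z]
  {S : Z → ProbabilityMeasure Z} {P : Measure (ℕ → Z)} [IsProbabilityMeasure P] {T : Set Z}
  {H : ℕ → Z → ℝ≥0∞}

/-- The chain avoids `T` up to time `n`. -/
def avoids (T : Set Z) (n : ℕ) : Set (ℕ → Z) :=
  {w | (fun i : Fin (n + 1) => w i) ∈ {h : Fin (n + 1) → Z | ∀ i, h i ∉ T}}

theorem mem_avoids {n : ℕ} {w : ℕ → Z} : w ∈ avoids T n ↔ ∀ i ≤ n, w i ∉ T :=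
  ⟨fun h i hi => h ⟨i, Nat.lt_succ_of_le hi⟩, fun h i => h i (Nat.lt_succ_iff.1 i.2)⟩

theorem measurableSet_avoids_history (hT : MeasurableSet T) (n : ℕ) :
    MeasurableSet {h : Fin (n + 1) → Z | ∀ i, h i ∉ T} := by
  simp only [Set.ofPred_forall]
  exact MeasurableSet.iInter fun i =>
    (measurable_pi_apply i : Measurable fun h : Fin (n + 1) → Z => h i) hT.compl

/-- Induction on the horizon `l`, for all times `n` at once. Split on whether time `n + 1` hits `T`:
a hit pays at most `1` and is counted on the right, a miss is the claim for `l` at time `n + 1`. -/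
theorem setLIntegral_avoids_le (hS : UniversallyMeasurable S)
    (hstep : ∀ (n : ℕ) (A : Set (Fin (n + 1) → Z)) (B : Set Z), MeasurableSet A →
      MeasurableSet B → P {w | (fun i : Fin (n + 1) => w i) ∈ A ∧ w (n + 1) ∈ B} =
        ∫⁻ w in {w | (fun i : Fin (n + 1) => w i) ∈ A}, (S (w n) : Measure Z) B ∂P)
    (hT : MeasurableSet T) (hH : ∀ l, UniversallyMeasurable (H l))
    (hzero : ∀ z, H 0 z ≤ (S z : Measure Z) T)
    (hsucc : ∀ l z, H (l + 1) z ≤ ∫⁻ z', max (T.indicator 1 z') (H l z') ∂(S z : Measure Z))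
    (hH1 : ∀ l z, H l z ≤ 1) (l n : ℕ) :
    ∫⁻ w in avoids T n, H l (w n) ∂P ≤ P (avoids T n ∩ {w | ∃ m, w m ∈ T}) := by
  induction l generalizing n with
  | zero =>
    refine (lintegral_mono fun w : ℕ → Z => hzero (w n)).trans ?_
    rw [avoids, ← hstep n _ T (measurableSet_avoids_history hT n) hT]
    exact measure_mono fun w hw => ⟨hw.1, n + 1, hw.2⟩
  | succ l ih =>
    have hm : Measurable fun w : ℕ → Z => w (n + 1) := measurable_pi_apply _
    refine (lintegral_mono fun w : ℕ → Z => hsucc l (w n)).trans ?_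
    have heq := hS.setLIntegral_succ (measurableSet_avoids_history hT n)
      (hstep n _ · (measurableSet_avoids_history hT n))
      (UniversallyMeasurable.max (measurable_one.indicator hT).universallyMeasurable (hH l))
    rw [avoids, ← heq, ← avoids,
      ← lintegral_inter_add_sdiff _ (avoids T n) (hm hT),
      ← measure_inter_add_sdiff (avoids T n ∩ {w | ∃ m, w m ∈ T}) (hm hT)]
    refine add_le_add ?_ ?_
    · calc ∫⁻ w in avoids T n ∩ (fun w => w (n + 1)) ⁻¹' T,
            max (T.indicator 1 (w (n + 1))) (H l (w (n + 1))) ∂P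
          ≤ ∫⁻ w in avoids T n ∩ (fun w => w (n + 1)) ⁻¹' T, 1 ∂P :=
            lintegral_mono fun w => max_le (indicator_one_le_one T _) (hH1 l _)
        _ = P (avoids T n ∩ (fun w => w (n + 1)) ⁻¹' T) := by simp
        _ ≤ _ := measure_mono fun w hw => by
            exact ⟨⟨hw.1, n + 1, hw.2⟩, hw.2⟩
    · have hset : avoids T n \ (fun w => w (n + 1)) ⁻¹' T = avoids T (n + 1) := by
        ext w
        simp only [Set.mem_sdiff, mem_avoids, Set.mem_preimage, Nat.le_succ_iff]
        exact ⟨fun h i hi => hi.elim (h.1 i) fun hi => hi ▸ h.2,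
          fun h => ⟨fun i hi => h i (Or.inl hi), h _ (Or.inr rfl)⟩⟩
      have hset' : (avoids T n ∩ {w | ∃ m, w m ∈ T}) \ (fun w => w (n + 1)) ⁻¹' T =
          avoids T (n + 1) ∩ {w | ∃ m, w m ∈ T} := by
        rw [← hset]; exact Set.inter_sdiff_right_comm
      rw [hset, hset']
      refine le_trans (lintegral_mono_ae ?_) (ih (n + 1))
      have hmeas : MeasurableSet (avoids T (n + 1)) :=
        (measurable_pi_lambda _ fun i => measurable_pi_apply _ :
          Measurable fun (w : ℕ → Z) (i : Fin (n + 2)) => w i)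
          (measurableSet_avoids_history hT (n + 1))
      filter_upwards [ae_restrict_mem hmeas] with w hw
      rw [Set.indicator_of_notMem (mem_avoids.1 hw _ le_rfl)]
      simp

/-- If the start lies in `T` then `H l ≤ 1` suffices; otherwise this is the preceding estimate at
time `0`. -/
theorem le_measure_reach [MeasurableSingletonClass Z] (hS : UniversallyMeasurable S) {z₀ : Z}
    (hinit : P.map (fun w => w 0) = Measure.dirac z₀)
    (hstep : ∀ (n : ℕ) (A : Set (Fin (n + 1) → Z)) (B : Set Z), MeasurableSet A →
      MeasurableSet B → P {w | (fun i : Fin (n + 1) => w i) ∈ A ∧ w (n + 1) ∈ B} =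
        ∫⁻ w in {w | (fun i : Fin (n + 1) => w i) ∈ A}, (S (w n) : Measure Z) B ∂P)
    (hT : MeasurableSet T) (hH : ∀ l, UniversallyMeasurable (H l))
    (hzero : ∀ z, H 0 z ≤ (S z : Measure Z) T)
    (hsucc : ∀ l z, H (l + 1) z ≤ ∫⁻ z', max (T.indicator 1 z') (H l z') ∂(S z : Measure Z))
    (hH1 : ∀ l z, H l z ≤ 1) (l : ℕ) :
    H l z₀ ≤ P {w | ∃ m, w m ∈ T} := by
  have hm : Measurable fun w : ℕ → Z => w 0 := measurable_pi_apply _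
  have h0 : H l z₀ = ∫⁻ w, H l (w 0) ∂P := by
    rw [← lintegral_map' (μ := P) (f := H l) (by rw [hinit]; exact (hH l).aemeasurable _)
      hm.aemeasurable, hinit, lintegral_dirac]
  have hset : avoids T 0 = (fun w => w 0) ⁻¹' Tᶜ := by
    ext w
    simp [mem_avoids]
  have hmeas : MeasurableSet (avoids T 0) := hset ▸ hm hT.compl
  rw [h0, ← lintegral_add_compl _ hmeas, ← measure_inter_add_sdiff {w | ∃ m, w m ∈ T} hmeas]
  refine add_le_add ?_ ?_
  · rw [Set.inter_comm]
    exact setLIntegral_avoids_le hS hstep hT hH hzero hsucc hH1 l 0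
  · calc ∫⁻ w in (avoids T 0)ᶜ, H l (w 0) ∂P ≤ ∫⁻ w in (avoids T 0)ᶜ, 1 ∂P :=
          lintegral_mono fun w => hH1 l _
      _ = P (avoids T 0)ᶜ := by simp
      _ ≤ _ := measure_mono fun w hw => by
          refine ⟨⟨0, ?_⟩, hw⟩
          simpa [hset] using hw

end Reach

theorem GMDP.universallyMeasurable_lintegral_transMixed {X U Y Z : Type*} [MeasurableSpace X]
    [MeasurableSpace U] [MeasurableSpace Y] [MeasurableSpace Z]
    [MeasurableSpace.CountablyGenerated X] [MeasurableSpace.CountablyGenerated U]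
    (M : GMDP X U Y) {g : Z → X} (hg : Measurable g) {κ : Z → ProbabilityMeasure U}
    (hκ : UniversallyMeasurable κ) {f : X × Z → ℝ≥0∞} (hf : UniversallyMeasurable f) :
    UniversallyMeasurable fun z => ∫⁻ x', f (x', z) ∂(M.transMixed (g z) (κ z)) := by
  have : (fun z => ∫⁻ x', f (x', z) ∂(M.transMixed (g z) (κ z))) = fun z => ∫⁻ u, ∫⁻ x',
      f (x', z) ∂(M.transProb (g z, u) : Measure X) ∂(κ z : Measure U) :=
    funext fun z => M.lintegral_transMixed _ _ (hf.comp_measurable measurable_prodMk_right)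
  rw [this]
  refine hκ.lintegral (f := fun p : Z × U => ∫⁻ x', f (x', p.1) ∂(M.transProb (g p.1, p.2) :
    Measure X)) ?_
  exact UniversallyMeasurable.lintegral (K := fun p : Z × U => M.transProb (g p.1, p.2))
    (f := fun q : (Z × U) × X => f (q.2, q.1.1))
    (M.measurable_transProb.comp (by fun_prop)).universallyMeasurable
    (hf.comp_measurable (by fun_prop))

/-! ### The refined control strategy -/

section Refinement

variable {Xh Uh Q X U : Type u} {Y AP : Type*}
  [TopologicalSpace Xh] [PolishSpace Xh] [MeasurableSpace Xh] [BorelSpace Xh]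
  [TopologicalSpace Uh] [PolishSpace Uh] [MeasurableSpace Uh] [BorelSpace Uh]
  [TopologicalSpace X] [PolishSpace X] [MeasurableSpace X] [BorelSpace X]
  [TopologicalSpace U] [PolishSpace U] [MeasurableSpace U] [BorelSpace U]
  [MeasurableSpace Y]
  [Finite AP] [Finite Q] [TopologicalSpace Q] [DiscreteTopology Q] [MeasurableSpace Q]
  [BorelSpace Q]

/-- The memory of the refined strategy: a flag that tells whether a step has been made, the last
abstract input, abstract state and concrete state, and the location of the automaton. -/
abbrev RefinedMem (Xh Uh Q X : Type u) : Type u := ULift.{u} Bool × (Uh × Xh × X) × Q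

/-- The location of the automaton after the label of the current concrete state has been read. -/
def nextLoc (M : GMDP X U Y) (L : Labelling Y AP) (A : DFA (Set AP) Q)
    (p : RefinedMem Xh Uh Q X × X) : Q :=
  A.step p.1.2.2 (L.label (M.out p.2))

theorem measurable_nextLoc (M : GMDP X U Y) (L : Labelling Y AP) (A : DFA (Set AP) Q) :
    Measurable (nextLoc (Xh := Xh) (Uh := Uh) M L A) :=
  (L.measurable_step A).comp
    (f := fun p : RefinedMem Xh Uh Q X × X => (M.out p.2, p.1.2.2))
    ((M.measurable_out.comp measurable_snd).prodMk (by fun_prop))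

/-- The law of the current abstract state given the memory and the current concrete state. -/
def abstractLaw (K : Kernel ((Uh × Xh × X) × X) Xh) [IsMarkovKernel K] (x₀ : Xh)
    (p : RefinedMem Xh Uh Q X × X) : ProbabilityMeasure Xh :=
  if p.1.1.down = true then ⟨K (p.1.2.1, p.2), inferInstance⟩
  else ⟨Measure.dirac x₀, inferInstance⟩

theorem measurable_abstractLaw (K : Kernel ((Uh × Xh × X) × X) Xh) [IsMarkovKernel K] (x₀ : Xh) :
    Measurable (abstractLaw (Q := Q) K x₀) := by
  refine Measurable.ite ?_ ?_ measurable_const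
  · have : Measurable fun p : RefinedMem Xh Uh Q X × X => p.1.1 := by fun_prop
    exact this (MeasurableSet.of_discrete (s := {b : ULift.{u} Bool | b.down = true}))
  · exact (K.measurable.comp (by fun_prop :
      Measurable fun p : RefinedMem Xh Uh Q X × X => (p.1.2.1, p.2))).subtype_mk

/-- The next memory state when the current abstract state and the next abstract input are known. -/
def nextMemory (M : GMDP X U Y) (L : Labelling Y AP) (A : DFA (Set AP) Q)
    (r : ((RefinedMem Xh Uh Q X × X) × Xh) × Uh) : RefinedMem Xh Uh Q X :=
  (⟨true⟩, (r.2, r.1.2, r.1.1.2), nextLoc M L A r.1.1)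

theorem measurable_nextMemory (M : GMDP X U Y) (L : Labelling Y AP) (A : DFA (Set AP) Q) :
    Measurable (nextMemory (Xh := Xh) (Uh := Uh) M L A) :=
  measurable_const.prodMk (Measurable.prodMk (by fun_prop)
    ((measurable_nextLoc M L A).comp (measurable_fst.comp measurable_fst)))

theorem measurable_diracProba {Z : Type*} [MeasurableSpace Z] :
    Measurable (diracProba : Z → ProbabilityMeasure Z) :=
  Measure.measurable_dirac.subtype_mk

/-- The law of the next memory state when the current abstract state is known. -/
def memoryLaw (M : GMDP X U Y) (L : Labelling Y AP) (A : DFA (Set AP) Q)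
    (μ : StationaryPolicy (Xh × Q) Uh) (p : (RefinedMem Xh Uh Q X × X) × Xh) :
    ProbabilityMeasure (RefinedMem Xh Uh Q X) :=
  (μ.act (p.2, nextLoc M L A p.1)).univBind (fun u => diracProba (nextMemory M L A (p, u)))
    (measurable_diracProba.comp
      ((measurable_nextMemory M L A).comp measurable_prodMk_left)).universallyMeasurable

theorem universallyMeasurable_memoryLaw (M : GMDP X U Y) (L : Labelling Y AP) (A : DFA (Set AP) Q)
    (μ : StationaryPolicy (Xh × Q) Uh) :
    UniversallyMeasurable (memoryLaw (X := X) M L A μ) :=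
  (μ.universallyMeasurable_act.comp_measurable (measurable_snd.prodMk
      ((measurable_nextLoc M L A).comp measurable_fst))).univBind
    (measurable_diracProba.comp (measurable_nextMemory M L A)).universallyMeasurable

/-- The control strategy for the concrete model that simulates the abstract model. -/
def refinedStrategy (Mh : GMDP Xh Uh Y) (M : GMDP X U Y) (L : Labelling Y AP) (A : DFA (Set AP) Q)
    (μ : StationaryPolicy (Xh × Q) Uh) (Uv : Uh × Xh × X → ProbabilityMeasure U)
    (hUv : UniversallyMeasurable Uv) (K : Kernel ((Uh × Xh × X) × X) Xh) [IsMarkovKernel K] :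
    ControlStrategy X U where
  Mem := RefinedMem Xh Uh Q X
  init := (⟨false⟩, ((nonempty_of_isProbabilityMeasure (μ.act (Mh.init, A.start) : Measure Uh)).some,
    Mh.init, M.init), A.start)
  trans := fun p => (abstractLaw K Mh.init p).univBind (fun xh => memoryLaw M L A μ (p, xh))
    ((universallyMeasurable_memoryLaw M L A μ).comp_measurable measurable_prodMk_left)
  universallyMeasurable_trans :=
    (measurable_abstractLaw K Mh.init).universallyMeasurable.univBind
      (universallyMeasurable_memoryLaw M L A μ)
  -- The output map sees only the memory, so the triple must contain the concrete state just read.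
  out := fun c => Uv c.2.1
  universallyMeasurable_out := hUv.comp_measurable (by fun_prop)

section Properties

variable {Mh : GMDP Xh Uh Y} {M : GMDP X U Y} {L : Labelling Y AP} {A : DFA (Set AP) Q}
  {μ : StationaryPolicy (Xh × Q) Uh} {Uv : Uh × Xh × X → ProbabilityMeasure U}
  {hUv : UniversallyMeasurable Uv} {K : Kernel ((Uh × Xh × X) × X) Xh} [IsMarkovKernel K]

variable (Mh M L A μ Uv hUv K) in
/-- The one-step law of the concrete model under the refined strategy. -/
def refinedStep (z : X × RefinedMem Xh Uh Q X) : ProbabilityMeasure (X × RefinedMem Xh Uh Q X) :=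
  (refinedStrategy Mh M L A μ Uv hUv K).stepLaw M z

theorem universallyMeasurable_refinedStep :
    UniversallyMeasurable (refinedStep Mh M L A μ Uv hUv K) :=
  (refinedStrategy Mh M L A μ Uv hUv K).universallyMeasurable_stepLaw M

theorem lintegral_refinedStep (z : X × RefinedMem Xh Uh Q X)
    {f : X × RefinedMem Xh Uh Q X → ℝ≥0∞} (hf : UniversallyMeasurable f) :
    ∫⁻ z', f z' ∂(refinedStep Mh M L A μ Uv hUv K z : Measure (X × RefinedMem Xh Uh Q X)) =
      ∫⁻ xh, ∫⁻ u, ∫⁻ x', f (x', (⟨true⟩, (u, xh, z.1), nextLoc M L A (z.2, z.1)))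
        ∂(M.transMixed z.1 (Uv (u, xh, z.1)))
        ∂(μ.act (xh, nextLoc M L A (z.2, z.1)) : Measure Uh)
        ∂(abstractLaw K Mh.init (z.2, z.1) : Measure Xh) := by
  refine ((refinedStrategy Mh M L A μ Uv hUv K).lintegral_stepLaw M z hf).trans ?_
  have hF : UniversallyMeasurable fun c' : RefinedMem Xh Uh Q X =>
      ∫⁻ x', f (x', c') ∂(M.transMixed z.1 (Uv c'.2.1)) :=
    M.universallyMeasurable_lintegral_transMixed measurable_const
      (hUv.comp_measurable (by fun_prop)) hf
  refine (ProbabilityMeasure.lintegral_univBind ((universallyMeasurable_memoryLaw M L A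
    μ).comp_measurable measurable_prodMk_left) hF).trans (lintegral_congr fun xh => ?_)
  refine (ProbabilityMeasure.lintegral_univBind (measurable_diracProba.comp
    ((measurable_nextMemory M L A).comp measurable_prodMk_left)).universallyMeasurable hF).trans
    (lintegral_congr fun u => ?_)
  exact lintegral_dirac _ _

/-- The value of the abstract model as a function of the concrete execution; it counts only pairs
in the simulation relation. -/
def pairValue (A : DFA (Set AP) Q) (R : Set (Xh × X)) (V : Xh × Q → ℝ≥0∞)
    (p : (Xh × X) × Q) : ℝ≥0∞ :=
  R.indicator 1 p.1 * max ((targetSet Xh A).indicator 1 (p.1.1, p.2)) (V (p.1.1, p.2))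

/-- The expected value of `pairValue` under the law of the current abstract state. -/
def concreteValue (Mh : GMDP Xh Uh Y) (M : GMDP X U Y) (L : Labelling Y AP) (A : DFA (Set AP) Q)
    (K : Kernel ((Uh × Xh × X) × X) Xh) [IsMarkovKernel K] (R : Set (Xh × X))
    (V : Xh × Q → ℝ≥0∞) (z : X × RefinedMem Xh Uh Q X) : ℝ≥0∞ :=
  ∫⁻ xh, pairValue A R V ((xh, z.1), nextLoc M L A (z.2, z.1))
    ∂(abstractLaw K Mh.init (z.2, z.1) : Measure Xh)

variable {R : Set (Xh × X)} {V : Xh × Q → ℝ≥0∞}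

theorem measurableSet_targetSet : MeasurableSet (targetSet Xh A) :=
  measurable_snd (MeasurableSet.of_discrete (s := A.accept))

theorem pairValue_le_one (hV : ∀ z, V z ≤ 1) (p : (Xh × X) × Q) : pairValue A R V p ≤ 1 :=
  mul_le_one' (indicator_one_le_one _ _) (max_le (indicator_one_le_one _ _) (hV _))

theorem universallyMeasurable_pairValue (hR : MeasurableSet R) (hV : UniversallyMeasurable V) :
    UniversallyMeasurable (pairValue A R V) :=
  ((measurable_one.indicator hR).comp measurable_fst).universallyMeasurable.mul
    ((universallyMeasurable_stageValue measurableSet_targetSet hV).comp_measurable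
      (f := fun p : (Xh × X) × Q => (p.1.1, p.2)) (by fun_prop))

theorem concreteValue_le_one (hV : ∀ z, V z ≤ 1) (z : X × RefinedMem Xh Uh Q X) :
    concreteValue Mh M L A K R V z ≤ 1 :=
  (lintegral_mono (g := fun _ => 1) fun _ => pairValue_le_one hV _).trans (by simp)

theorem universallyMeasurable_concreteValue (hR : MeasurableSet R)
    (hV : UniversallyMeasurable V) : UniversallyMeasurable (concreteValue Mh M L A K R V) := by
  have := (measurable_abstractLaw (Q := Q) K Mh.init).universallyMeasurable.lintegral
    (f := fun r => pairValue A R V ((r.2, r.1.2), nextLoc M L A r.1))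
    ((universallyMeasurable_pairValue hR hV).comp_measurable
      (Measurable.prodMk (by fun_prop) ((measurable_nextLoc M L A).comp measurable_fst)))
  exact this.comp_measurable measurable_swap

end Properties

end Refinement

/-! ### Disintegration of the simulation kernel -/

section Disintegration

variable {Xh X T : Type*} [MeasurableSpace Xh] [StandardBorelSpace Xh] [Nonempty Xh]
  [MeasurableSpace X] [MeasurableSpace.CountablyGenerated X] [MeasurableSpace T]

/-- The conditional law of the first component given the second. -/
def condFst (W : Kernel T (Xh × X)) [IsMarkovKernel W] : Kernel (T × X) Xh :=
  W.swapRight.condKernel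

instance (W : Kernel T (Xh × X)) [IsMarkovKernel W] : IsMarkovKernel (condFst W) :=
  inferInstanceAs (IsMarkovKernel W.swapRight.condKernel)

/-- Sampling the concrete state first and the abstract one conditionally recovers the coupling; this
lets the strategy postpone the abstract draw until it has seen the concrete state. -/
theorem lintegral_condFst (W : Kernel T (Xh × X)) [IsMarkovKernel W] (a : T)
    {f : Xh × X → ℝ≥0∞} (hf : UniversallyMeasurable f) :
    ∫⁻ x', ∫⁻ xh', f (xh', x') ∂(condFst W (a, x')) ∂((W a).map Prod.snd) =
      ∫⁻ p, f p ∂(W a) := by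
  have hf' : UniversallyMeasurable fun p : X × Xh => f p.swap := hf.comp_measurable measurable_swap
  have h1 : ∫⁻ p, f p ∂(W a) = ∫⁻ p, f p.swap ∂(W.swapRight a) := by
    rw [Kernel.swapRight_apply, lintegral_map' _ measurable_swap.aemeasurable]
    · simp
    · have := Measure.isProbabilityMeasure_map (μ := W a) measurable_swap.aemeasurable
      exact hf'.aemeasurable _
  rw [h1, ← W.swapRight.disintegrate W.swapRight.condKernel, Kernel.lintegral_compProd₀]
  · rw [Kernel.fst_apply, Kernel.swapRight_apply, Measure.map_map measurable_fst measurable_swap]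
    rfl
  · rw [W.swapRight.disintegrate W.swapRight.condKernel]
    exact hf'.aemeasurable _

end Disintegration

/-! ### Liftings and the one-step comparison of the two models -/

theorem IsLifting.map_fst {X₁ X₂ : Type*} [MeasurableSpace X₁] [MeasurableSpace X₂]
    {R : Set (X₁ × X₂)} {δ : ℝ≥0} {Δ : Measure X₁} {Θ : Measure X₂} {W : Measure (X₁ × X₂)}
    (h : IsLifting R δ Δ Θ W) : W.map Prod.fst = Δ := by
  ext s hs
  rw [Measure.map_apply measurable_fst hs, ← h.left s hs, Set.prod_univ]

theorem IsLifting.map_snd {X₁ X₂ : Type*} [MeasurableSpace X₁] [MeasurableSpace X₂]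
    {R : Set (X₁ × X₂)} {δ : ℝ≥0} {Δ : Measure X₁} {Θ : Measure X₂} {W : Measure (X₁ × X₂)}
    (h : IsLifting R δ Δ Θ W) : W.map Prod.snd = Θ := by
  ext s hs
  rw [Measure.map_apply measurable_snd hs, ← h.right s hs, Set.univ_prod]

theorem IsLifting.measure_compl_le {X₁ X₂ : Type*} [MeasurableSpace X₁] [MeasurableSpace X₂]
    {R : Set (X₁ × X₂)} {δ : ℝ≥0} {Δ : Measure X₁} {Θ : Measure X₂} {W : Measure (X₁ × X₂)}
    [IsProbabilityMeasure W] (h : IsLifting R δ Δ Θ W) (hR : MeasurableSet R) : W Rᶜ ≤ δ := by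
  rw [prob_compl_eq_one_sub hR, tsub_le_iff_right, add_comm, ← tsub_le_iff_right]
  exact h.rel

section Refinement

variable {Xh Uh Q X U : Type u} {Y AP : Type*}
  [TopologicalSpace Xh] [PolishSpace Xh] [MeasurableSpace Xh] [BorelSpace Xh]
  [TopologicalSpace Uh] [PolishSpace Uh] [MeasurableSpace Uh] [BorelSpace Uh]
  [TopologicalSpace X] [PolishSpace X] [MeasurableSpace X] [BorelSpace X]
  [TopologicalSpace U] [PolishSpace U] [MeasurableSpace U] [BorelSpace U]
  [MetricSpace Y] [MeasurableSpace Y]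
  [Finite AP] [Finite Q] [TopologicalSpace Q] [DiscreteTopology Q] [MeasurableSpace Q]
  [BorelSpace Q]
  {Mh : GMDP Xh Uh Y} {M : GMDP X U Y} {L : Labelling Y AP} {A : DFA (Set AP) Q}
  {μ : StationaryPolicy (Xh × Q) Uh} {δ : ℝ≥0} {R : Set (Xh × X)}
  {Uv : Uh × Xh × X → ProbabilityMeasure U} {W : Kernel (Uh × Xh × X) (Xh × X)}
  {V : Xh × Q → ℝ≥0∞}

theorem IsStochSimulation.out_eq (h : IsStochSimulation Mh M 0 δ R Uv W) {xh : Xh} {x : X}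
    (hx : (xh, x) ∈ R) : Mh.out xh = M.out x :=
  dist_le_zero.1 (h.dist_out xh x hx)

/-- One step of the abstract model loses at most `δ` against the concrete model, because the
simulation kernel leaves the relation with probability at most `δ`. -/
theorem IsStochSimulation.lintegral_trans_le [Nonempty Xh] [IsMarkovKernel W]
    (h : IsStochSimulation Mh M 0 δ R Uv W) {xh : Xh} {x : X} (hx : (xh, x) ∈ R) (u : Uh) (q : Q)
    (hV : UniversallyMeasurable V) (hV1 : ∀ z, V z ≤ 1) :
    ∫⁻ z', max ((targetSet Xh A).indicator 1 z') (V z') ∂((Mh.prodDFA L A).trans ((xh, q), u)) ≤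
      ∫⁻ x', ∫⁻ xh', pairValue A R V ((xh', x'), A.step q (L.label (M.out x')))
        ∂(condFst W ((u, xh, x), x')) ∂(M.transMixed x (Uv (u, xh, x))) + δ := by
  have hlift := h.lifting xh x hx u
  have hR := h.measurableSet_rel
  have hm := universallyMeasurable_stageValue (measurableSet_targetSet (A := A)) hV
  have hstep : Measurable fun x' : X => A.step q (L.label (M.out x')) :=
    (L.measurable_step A).comp (M.measurable_out.prodMk measurable_const)
  have hsteph : Measurable fun xh' : Xh => (xh', A.step q (L.label (Mh.out xh'))) :=
    measurable_id.prodMk ((L.measurable_step A).comp (Mh.measurable_out.prodMk measurable_const))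
  have hfst : ∫⁻ z', max ((targetSet Xh A).indicator 1 z') (V z')
        ∂((Mh.prodDFA L A).trans ((xh, q), u)) =
      ∫⁻ p, max ((targetSet Xh A).indicator 1 (p.1, A.step q (L.label (Mh.out p.1))))
        (V (p.1, A.step q (L.label (Mh.out p.1)))) ∂(W (u, xh, x)) := by
    refine (lintegral_map' (hm.aemeasurable ((Mh.prodDFA L A).trans ((xh, q), u)))
      hsteph.aemeasurable).trans ?_
    rw [← hlift.map_fst]
    have := Measure.isProbabilityMeasure_map (μ := W (u, xh, x)) measurable_fst.aemeasurable
    exact lintegral_map' ((hm.comp_measurable hsteph).aemeasurable _) measurable_fst.aemeasurable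
  have hsnd := lintegral_condFst W (u, xh, x)
    (f := fun p => pairValue A R V (p, A.step q (L.label (M.out p.2))))
    ((universallyMeasurable_pairValue hR hV).comp_measurable
      (measurable_id.prodMk (hstep.comp measurable_snd)))
  rw [hlift.map_snd] at hsnd
  rw [hsnd, hfst]
  -- Both sides are now integrals over the coupling. On `R` the outputs, hence the locations,
  -- coincide; off `R` the loss is at most `1`.
  calc _ ≤ ∫⁻ p, (pairValue A R V (p, A.step q (L.label (M.out p.2))) +
            Rᶜ.indicator 1 p) ∂(W (u, xh, x)) := by
        refine lintegral_mono fun p => ?_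
        by_cases hp : p ∈ R
        · have := h.out_eq (xh := p.1) (x := p.2) hp
          simp [pairValue, hp, this]
        · simpa [pairValue, hp] using
            max_le (indicator_one_le_one (targetSet Xh A) _) (hV1 _)
    _ ≤ _ := by
        rw [lintegral_add_right _ (measurable_one.indicator hR.compl),
          lintegral_indicator_one hR.compl]
        gcongr
        exact hlift.measure_compl_le hR

variable {hUv : UniversallyMeasurable Uv}

/-- The subtracted `δ` pays for leaving the relation. It suffices to compare for each current
abstract state: off `R` the left side is zero, at an accepting location the right side is at least
`1`, and otherwise `lintegral_trans_le` is averaged over the abstract input. -/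
theorem IsStochSimulation.concreteValue_robustBellman_le [Nonempty Xh] [IsMarkovKernel W]
    (h : IsStochSimulation Mh M 0 δ R Uv W) (hV : UniversallyMeasurable V) (hV1 : ∀ z, V z ≤ 1)
    (z : X × RefinedMem Xh Uh Q X) :
    concreteValue Mh M L A (condFst W) R
        (robustBellman (Mh.prodDFA L A) (targetSet Xh A) μ δ V) z ≤
      ∫⁻ z', max ({z : X × RefinedMem Xh Uh Q X | z.2.2.2 ∈ A.accept}.indicator 1 z')
        (concreteValue Mh M L A (condFst W) R V z')
        ∂(refinedStep Mh M L A μ Uv hUv (condFst W) z : Measure (X × RefinedMem Xh Uh Q X)) := by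
  have hR := h.measurableSet_rel
  have hT : MeasurableSet {z : X × RefinedMem Xh Uh Q X | z.2.2.2 ∈ A.accept} :=
    (by fun_prop : Measurable fun z : X × RefinedMem Xh Uh Q X => z.2.2.2)
      (MeasurableSet.of_discrete (s := A.accept))
  rw [lintegral_refinedStep z
    (.max (measurable_one.indicator hT).universallyMeasurable
      (universallyMeasurable_concreteValue hR hV))]
  refine lintegral_mono fun xh => ?_
  set q := nextLoc M L A (z.2, z.1) with hq
  by_cases hx : (xh, z.1) ∈ R
  swap
  · simp [pairValue, hx]
  by_cases hqF : q ∈ A.accept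
  · calc pairValue A R _ ((xh, z.1), q) ≤ 1 := pairValue_le_one robustBellman_le_one _
      _ = ∫⁻ u, ∫⁻ _, 1 ∂(M.transMixed z.1 (Uv (u, xh, z.1)))
          ∂(μ.act (xh, q) : Measure Uh) := by simp
      _ ≤ _ := by
        refine lintegral_mono fun u => lintegral_mono fun x' => ?_
        refine le_max_of_le_left ?_
        rw [Set.indicator_of_mem (by exact hqF)]
        exact le_rfl
  · have hb : bellman (Mh.prodDFA L A) (targetSet Xh A) μ V (xh, q) ≤
        ∫⁻ u, ∫⁻ x', concreteValue Mh M L A (condFst W) R V (x', (⟨true⟩, (u, xh, z.1), q))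
          ∂(M.transMixed z.1 (Uv (u, xh, z.1))) ∂(μ.act (xh, q) : Measure Uh) + δ := by
      refine ((Mh.prodDFA L A).lintegral_transMixed _ _
        (universallyMeasurable_stageValue measurableSet_targetSet hV)).trans_le ?_
      calc _ ≤ ∫⁻ u, (∫⁻ x', concreteValue Mh M L A (condFst W) R V
                (x', (⟨true⟩, (u, xh, z.1), q)) ∂(M.transMixed z.1 (Uv (u, xh, z.1))) + δ)
              ∂(μ.act (xh, q) : Measure Uh) :=
            -- With the flag true, `concreteValue` unfolds to the inner integral against `condFst
            -- W`.
            lintegral_mono fun u => h.lintegral_trans_le hx u q hV hV1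
        _ = _ := by rw [lintegral_add_right _ measurable_const]; simp
    have hnot : (xh, q) ∉ targetSet Xh A := hqF
    calc pairValue A R _ ((xh, z.1), q)
        = robustBellman (Mh.prodDFA L A) (targetSet Xh A) μ δ V (xh, q) := by
          simp [pairValue, hx, hnot]
      _ ≤ bellman (Mh.prodDFA L A) (targetSet Xh A) μ V (xh, q) - δ := min_le_right _ _
      _ ≤ _ := tsub_le_iff_right.2 hb
      _ ≤ _ := lintegral_mono fun u => lintegral_mono fun x' => le_max_right _ _

/-- Only an accepting location after reading the current label has value here, and that location
enters the memory with certainty at the next step. The memory thus lags one label behind, which is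
why horizon `0` already costs one step. -/
theorem IsStochSimulation.concreteValue_zero_le [Nonempty Xh] [IsMarkovKernel W]
    (z : X × RefinedMem Xh Uh Q X) :
    concreteValue Mh M L A (condFst W) R 0 z ≤
      (refinedStep Mh M L A μ Uv hUv (condFst W) z : Measure (X × RefinedMem Xh Uh Q X))
        {z | z.2.2.2 ∈ A.accept} := by
  have hT : MeasurableSet {z : X × RefinedMem Xh Uh Q X | z.2.2.2 ∈ A.accept} :=
    (by fun_prop : Measurable fun z : X × RefinedMem Xh Uh Q X => z.2.2.2)
      (MeasurableSet.of_discrete (s := A.accept))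
  rw [← lintegral_indicator_one hT,
    lintegral_refinedStep z (measurable_one.indicator hT).universallyMeasurable]
  refine lintegral_mono fun xh => ?_
  by_cases hqF : nextLoc M L A (z.2, z.1) ∈ A.accept
  · calc pairValue A R _ ((xh, z.1), _) ≤ 1 := pairValue_le_one (fun _ => zero_le) _
      _ = ∫⁻ u, ∫⁻ _, 1 ∂(M.transMixed z.1 (Uv (u, xh, z.1)))
          ∂(μ.act (xh, nextLoc M L A (z.2, z.1)) : Measure Uh) := by simp
      _ ≤ _ := by
        refine lintegral_mono fun u => lintegral_mono fun x' => ?_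
        rw [Set.indicator_of_mem (by exact hqF)]
        exact le_rfl
  · have hnot : (xh, nextLoc M L A (z.2, z.1)) ∉ targetSet Xh A := hqF
    simp [pairValue, hnot]

end Refinement

/-! ### Executions under the refined strategy -/

section Refinement

variable {Xh Uh Q X U : Type u} {Y AP : Type*}
  [TopologicalSpace Xh] [PolishSpace Xh] [MeasurableSpace Xh] [BorelSpace Xh]
  [TopologicalSpace Uh] [PolishSpace Uh] [MeasurableSpace Uh] [BorelSpace Uh]
  [TopologicalSpace X] [PolishSpace X] [MeasurableSpace X] [BorelSpace X]
  [TopologicalSpace U] [PolishSpace U] [MeasurableSpace U] [BorelSpace U]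
  [MetricSpace Y] [MeasurableSpace Y]
  [Finite AP] [Finite Q] [TopologicalSpace Q] [DiscreteTopology Q] [MeasurableSpace Q]
  [BorelSpace Q]
  {Mh : GMDP Xh Uh Y} {M : GMDP X U Y} {L : Labelling Y AP} {A : DFA (Set AP) Q}
  {μ : StationaryPolicy (Xh × Q) Uh} {Uv : Uh × Xh × X → ProbabilityMeasure U}
  {hUv : UniversallyMeasurable Uv}

theorem IsExecutionLaw.refined_zero {K : Kernel ((Uh × Xh × X) × X) Xh} [IsMarkovKernel K]
    {P : Measure (ℕ → X × RefinedMem Xh Uh Q X)}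
    (hP : IsExecutionLaw (refinedStrategy Mh M L A μ Uv hUv K) M P) :
    P.map (fun w => w 0) = Measure.dirac
      ((M.init, (refinedStrategy Mh M L A μ Uv hUv K).init) : X × RefinedMem Xh Uh Q X) :=
  hP.map_zero

theorem IsExecutionLaw.refined_step {K : Kernel ((Uh × Xh × X) × X) Xh} [IsMarkovKernel K]
    {P : Measure (ℕ → X × RefinedMem Xh Uh Q X)}
    (hP : IsExecutionLaw (refinedStrategy Mh M L A μ Uv hUv K) M P) (n : ℕ)
    (E : Set (Fin (n + 1) → X × RefinedMem Xh Uh Q X)) (B : Set (X × RefinedMem Xh Uh Q X))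
    (hE : MeasurableSet E) (hB : MeasurableSet B) :
    P {w | (fun i : Fin (n + 1) => w i) ∈ E ∧ w (n + 1) ∈ B} =
      ∫⁻ w in {w | (fun i : Fin (n + 1) => w i) ∈ E},
        (refinedStep Mh M L A μ Uv hUv K (w n) : Measure (X × RefinedMem Xh Uh Q X)) B ∂P :=
  (hP.step n E B hE hB).trans
    (lintegral_congr fun w => (ControlStrategy.stepLaw_apply _ M (w n) hB).symm)

/-- Almost surely the memory of the refined strategy tracks the run of the automaton. -/
theorem ae_memory_eq_run {K : Kernel ((Uh × Xh × X) × X) Xh} [IsMarkovKernel K]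
    {P : Measure (ℕ → X × RefinedMem Xh Uh Q X)}
    (hP : IsExecutionLaw (refinedStrategy Mh M L A μ Uv hUv K) M P) :
    ∀ᵐ w ∂P, ∀ t, (w t).2.2.2 = A.run (fun s => L.label (M.out (w s).1)) t := by
  have hloc : Measurable fun z : X × RefinedMem Xh Uh Q X => nextLoc M L A (z.2, z.1) :=
    (measurable_nextLoc M L A).comp measurable_swap
  have hstep : ∀ t, ∀ᵐ w ∂P, (w (t + 1)).2.2.2 = nextLoc M L A ((w t).2, (w t).1) := by
    intro t
    -- The step identity speaks of product events only, so the location is fixed first; finiteness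
    -- of `Q` then allows a union of null sets.
    have hq : ∀ q : Q, ∀ᵐ w ∂P, nextLoc M L A ((w t).2, (w t).1) = q → (w (t + 1)).2.2.2 = q := by
      intro q
      have hA : MeasurableSet {h : Fin (t + 1) → X × RefinedMem Xh Uh Q X |
          nextLoc M L A ((h (Fin.last t)).2, (h (Fin.last t)).1) = q} :=
        (hloc.comp (measurable_pi_apply (Fin.last t))) (measurableSet_singleton q)
      have hB : MeasurableSet {z : X × RefinedMem Xh Uh Q X | z.2.2.2 ≠ q} :=
        (by fun_prop : Measurable fun z : X × RefinedMem Xh Uh Q X => z.2.2.2)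
          (measurableSet_singleton q).compl
      have hhist : Measurable fun (w : ℕ → X × RefinedMem Xh Uh Q X) (i : Fin (t + 1)) => w i :=
        measurable_pi_lambda _ fun i => measurable_pi_apply _
      have hnull : ∀ w : ℕ → X × RefinedMem Xh Uh Q X, nextLoc M L A ((w t).2, (w t).1) = q →
          (refinedStep Mh M L A μ Uv hUv K (w t) : Measure (X × RefinedMem Xh Uh Q X))
            {z | z.2.2.2 ≠ q} = 0 := by
        intro w hw
        rw [← lintegral_indicator_one hB,
          lintegral_refinedStep _ (measurable_one.indicator hB).universallyMeasurable]
        simp [hw]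
      have h1 := (hP.refined_step t _ _ hA hB).trans
        ((setLIntegral_congr_fun (g := fun _ => 0) (hhist hA) hnull).trans lintegral_zero)
      rw [ae_iff]
      convert h1 using 2
      ext w
      simp [Classical.not_imp]
    filter_upwards [ae_all_iff.2 hq] with w hw
    exact hw _ rfl
  have hinit : ∀ᵐ w ∂P, (w 0).2.2.2 = A.start := by
    have h0 : ∀ᵐ z ∂(P.map fun w => w 0), z.2.2.2 = A.start := by
      rw [hP.refined_zero, ae_dirac_eq]
      exact rfl
    exact ae_of_ae_map (measurable_pi_apply 0).aemeasurable h0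
  filter_upwards [ae_all_iff.2 hstep, hinit] with w hw hw0 t
  induction t with
  | zero => exact hw0
  | succ t ih =>
    rw [hw t, nextLoc, ih]
    rfl

/-- The reachability bound holds at every horizon, so it passes to the supremum of the iterates; the
indicator part of the maximum is covered by horizon `0`. -/
theorem robustSatProb_le_of_reach {δ : ℝ≥0} {R : Set (Xh × X)}
    {W : Kernel (Uh × Xh × X) (Xh × X)} [Nonempty Xh] [IsMarkovKernel W]
    (h : IsStochSimulation Mh M 0 δ R Uv W) {P : Measure (ℕ → X × RefinedMem Xh Uh Q X)}
    (hP : IsExecutionLaw (refinedStrategy Mh M L A μ Uv hUv (condFst W)) M P) :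
    robustSatProb Mh L A μ δ ≤ P {w | ∃ t, (w t).2.2.2 ∈ A.accept} := by
  have hprob : IsProbabilityMeasure P := hP.isProbabilityMeasure
  set C := refinedStrategy Mh M L A μ Uv hUv (condFst W) with hC
  let N := Mh.prodDFA L A
  let G := targetSet Xh A
  let V : ℕ → Xh × Q → ℝ≥0∞ := fun l => (robustBellman N G μ δ)^[l] 0
  have hV (l : ℕ) : UniversallyMeasurable (V l) :=
    universallyMeasurable_robustIterate measurableSet_targetSet l
  have hV1 (l : ℕ) (z : Xh × Q) : V l z ≤ 1 := robustIterate_le_one l z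
  have hT : MeasurableSet {z : X × RefinedMem Xh Uh Q X | z.2.2.2 ∈ A.accept} :=
    (by fun_prop : Measurable fun z : X × RefinedMem Xh Uh Q X => z.2.2.2)
      (MeasurableSet.of_discrete (s := A.accept))
  have hreach (l : ℕ) : concreteValue Mh M L A (condFst W) R (V l) (M.init, C.init) ≤
      P {w | ∃ t, (w t).2.2.2 ∈ A.accept} := by
    refine le_measure_reach (S := refinedStep Mh M L A μ Uv hUv (condFst W))
      (T := {z : X × RefinedMem Xh Uh Q X | z.2.2.2 ∈ A.accept})
      (H := fun l => concreteValue Mh M L A (condFst W) R (V l))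
      universallyMeasurable_refinedStep hP.refined_zero hP.refined_step hT
      (fun l => universallyMeasurable_concreteValue h.measurableSet_rel (hV l))
      (fun z => IsStochSimulation.concreteValue_zero_le z) ?_
      (fun l => concreteValue_le_one (hV1 l)) l
    intro l z
    have : V (l + 1) = robustBellman N G μ δ (V l) := Function.iterate_succ_apply' _ _ _
    simp only [this]
    exact h.concreteValue_robustBellman_le (hV l) (hV1 l) z
  -- Initially the abstract state is deterministic and the pair of initial states lies in `R`, so no
  -- value is lost.
  have hval (l : ℕ) : concreteValue Mh M L A (condFst W) R (V l) (M.init, C.init) =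
      max (G.indicator 1 N.init) (V l N.init) := by
    have hN : N.init = (Mh.init, A.step A.start (L.label (M.out M.init))) := by
      rw [← h.out_eq h.init]; rfl
    have h1 : concreteValue Mh M L A (condFst W) R (V l) (M.init, C.init) =
        ∫⁻ xh, pairValue A R (V l) ((xh, M.init), A.step A.start (L.label (M.out M.init)))
          ∂(Measure.dirac Mh.init) := by
      simp only [concreteValue, abstractLaw, nextLoc]
      rfl
    rw [h1, lintegral_dirac, hN]
    simp [pairValue, h.init, G]
  refine max_le ?_ (iSup_le fun l => ?_)
  · exact (le_max_left _ _).trans ((hval 0).symm.le.trans (hreach 0))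
  · exact (le_max_right _ _).trans ((hval l).symm.le.trans (hreach l))

theorem exists_strategy_of_stochSimulated (ψ : ScLTL AP) (hA : A.Recognizes ψ) {δ : ℝ≥0}
    (h : StochSimulated Mh M 0 δ) :
    ∃ C : ControlStrategy X U, SatisfiesWithProbAtLeast C M L ψ (robustSatProb Mh L A μ δ) := by
  obtain ⟨R, Uv, W, hsim⟩ := h
  have : Nonempty Xh := ⟨Mh.init⟩
  have := hsim.isMarkovKernel
  refine ⟨refinedStrategy Mh M L A μ Uv hsim.universallyMeasurable_interface (condFst W),
    exists_isExecutionLaw _ M, fun P hP => ?_⟩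
  -- Almost surely the stored location is the run on the concrete word, so acceptance in the memory
  -- implies `ψ`.
  refine (robustSatProb_le_of_reach hsim hP).trans (measure_mono_ae ?_)
  filter_upwards [ae_memory_eq_run hP] with w hw
  rintro ⟨t, ht⟩
  exact (hA _).2 ⟨t, hw t ▸ ht⟩

end Refinement

end

theorem mainTheorem2
    {Xh Uh Q : Type u} {Y AP : Type*}
    [TopologicalSpace Xh] [PolishSpace Xh] [MeasurableSpace Xh] [BorelSpace Xh]
    [TopologicalSpace Uh] [PolishSpace Uh] [MeasurableSpace Uh] [BorelSpace Uh]
    [MetricSpace Y] [MeasurableSpace Y] [BorelSpace Y]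
    [Finite AP] [Finite Q] [TopologicalSpace Q] [DiscreteTopology Q] [MeasurableSpace Q]
    [BorelSpace Q]
    (Mh : GMDP Xh Uh Y) (L : Labelling Y AP) (ψ : ScLTL AP)
    (A : DFA (Set AP) Q) (hA : A.Recognizes ψ)
    (μ : StationaryPolicy (Xh × Q) Uh) (δ : ℝ≥0) :
    -- the function that defines the robust satisfaction probability is a fixed point of the
    -- robust operator, and it is the only one for positive `δ`
    (robustBellman (Mh.prodDFA L A) (targetSet Xh A) μ δ
        (robustValue (Mh.prodDFA L A) (targetSet Xh A) μ δ) =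
      robustValue (Mh.prodDFA L A) (targetSet Xh A) μ δ) ∧
    (0 < δ → ∀ V : Xh × Q → ℝ≥0∞, UniversallyMeasurable V →
      robustBellman (Mh.prodDFA L A) (targetSet Xh A) μ δ V = V →
      V = robustValue (Mh.prodDFA L A) (targetSet Xh A) μ δ) ∧
    -- it gives a robust satisfaction probability
    RobustlySatisfies Mh (μ.toStrategy Mh L A) L ψ 0 δ (robustSatProb Mh L A μ δ) ∧
    -- every model that simulates `Mh` has a strategy that achieves it
    (∀ (X U : Type u) [TopologicalSpace X] [PolishSpace X] [MeasurableSpace X] [BorelSpace X]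
      [TopologicalSpace U] [PolishSpace U] [MeasurableSpace U] [BorelSpace U] (M : GMDP X U Y),
      StochSimulated Mh M 0 δ →
        ∃ C : ControlStrategy X U,
          SatisfiesWithProbAtLeast C M L ψ (robustSatProb Mh L A μ δ)) := by

  have hG : MeasurableSet (targetSet Xh A) := measurableSet_targetSet
  -- Robust satisfaction unfolds to the last conjunct, so one construction proves both.
  exact ⟨robustBellman_robustValue hG, fun hδ _ hV hfix => eq_robustValue_of_fixed hG hδ hV hfix,
    fun _ _ _ _ _ _ _ _ _ _ _ h => exists_strategy_of_stochSimulated ψ hA h,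
    fun _ _ _ _ _ _ _ _ _ _ _ h => exists_strategy_of_stochSimulated ψ hA h⟩
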